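/- Let $\alpha\in(0,1)$ and $d\ge 1$. Let $\varphi_3^\alpha(x)=C_d^\alpha(|x|^2+1)^{-(d+1-\alpha)/2}$, $x\in\mathbb{R}^d$, where $C_d^\alpha>0$ is chosen so that $\|\varphi_3^\alpha\|_{L^1(\mathbb{R}^d)}=1$, and put $\phi_t(x)=t^{-d}\varphi_3^\alpha(x/t)$ for $t>0$. For $u\in W^{1,1}(\mathbb{R}^d)$ (real-valued) define $$\tilde u(x,t)=(|u|*\phi_t)(x),\qquad u^*(x)=\sup_{t>0}\tilde u(x,t).$$ (i) If $u\in W^{1,1}(\mathbb{R}^d)\cap C(\mathbb{R}^d)$, then $u^*$ is finite everywhere and continuous on $\mathbb{R}^d$, and it is subharmonic in the open set $\{x\in\mathbb{R}^d:\ u^*(x)>|u(x)|\}$ (for $u\ge 0$ this is the set $\{u^*>u\}$). Here a continuous function $f$ is subharmonic in an open set $\Omega$ if, for every closed ball $\overline B\subset\Omega$ and every function $h$ continuous on $\overline B$ and harmonic in $B$ with $f\le h$ on $\partial B$, one has $f\le h$ in $B$. (ii) Let $d=1$. The map $u\mapsto (u^*)'$ is well defined and bounded from $W^{1,1}(\mathbb{R})$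 to $L^1(\mathbb{R})$: for every $u\in W^{1,1}(\mathbb{R})$ the function $u^*$ is finite everywhere, does not depend on the representative of $u$, and has a weak derivative $(u^*)'$, unique almost everywhere, which belongs to $L^1(\mathbb{R})$; and there is a constant $C$, depending only on $\alpha$, such that $$\|(u^*)'\|_{L^1(\mathbb{R})}\le C\left(\|u\|_{L^1(\mathbb{R})}+\|u'\|_{L^1(\mathbb{R})}\right)\qquad\text{for all }u\in W^{1,1}(\mathbb{R}).$$ -/

import Mathlib

open MeasureTheory Metric

noncomputable section

namespace FracPoisson

section

variable {E : Type*} [NormedAddCommGroup E] [InnerProductSpace ℝ E] [MeasureSpace E]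

/-- The profile `(|x|² + 1)^{-(d+1-α)/2}`, where `d = dim E`. -/
def profile (E : Type*) [NormedAddCommGroup E] [InnerProductSpace ℝ E] (α : ℝ) (x : E) : ℝ :=
  1 / (‖x‖ ^ 2 + 1) ^ (((Module.finrank ℝ E : ℝ) + 1 - α) / 2)

/-- The fractional Poisson kernel `C (|x|² + 1)^{-(d+1-α)/2}` on `E`, with `d = dim E` and the
constant `C` that makes its integral equal to `1`. -/
def kernel (E : Type*) [NormedAddCommGroup E] [InnerProductSpace ℝ E] [MeasureSpace E]
    (α : ℝ) (x : E) : ℝ :=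
  (∫ y : E, profile E α y)⁻¹ * profile E α x

/-- The normalization `‖φ‖_1 = 1` of the (nonnegative) fractional Poisson kernel. -/
theorem integral_kernel [FiniteDimensional ℝ E] [BorelSpace E]
    [(volume : Measure E).IsAddHaarMeasure] {α : ℝ} (hα : α < 1) :
    ∫ x : E, kernel E α x = 1 := by
  have hform : profile E α = fun x : E =>
      ((1 : ℝ) + ‖x‖ ^ 2) ^ (-((Module.finrank ℝ E : ℝ) + 1 - α) / 2) := by
    funext x
    have h0 : (0 : ℝ) ≤ 1 + ‖x‖ ^ 2 := by positivity
    rw [profile, neg_div, Real.rpow_neg h0, one_div, add_comm (‖x‖ ^ 2)]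
  have hint : Integrable (profile E α) volume := by
    rw [hform]
    exact integrable_rpow_neg_one_add_norm_sq (by linarith)
  have hcont : Continuous (profile E α) := by
    rw [hform]
    exact Continuous.rpow_const (by fun_prop) (fun x => Or.inl (by positivity))
  have hpos : 0 < ∫ x : E, profile E α x := by
    refine integral_pos_of_integrable_nonneg_nonzero (x := 0) hcont hint (fun x => ?_) ?_
    · show 0 ≤ profile E α x
      unfold profile
      positivity
    · simp [profile]
  simp only [kernel]
  rw [integral_const_mul]
  exact inv_mul_cancel₀ hpos.ne'

/-- The dilation `φ_t(x) = t^{-d} φ(x / t)`, with `d = dim E`. -/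
def dilate (φ : E → ℝ) (t : ℝ) (x : E) : ℝ :=
  1 / t ^ Module.finrank ℝ E * φ (t⁻¹ • x)

/-- The extension `ũ(x, t) = (|u| * φ_t)(x)`. -/
def extension (φ : E → ℝ) (u : E → ℝ) (x : E) (t : ℝ) : ℝ :=
  convolution (fun y => |u y|) (dilate φ t) (ContinuousLinearMap.mul ℝ ℝ) volume x

/-- The values `ũ(x, t)`, `t > 0`, whose supremum is the maximal function at `x`. -/
def extensionValues (φ : E → ℝ) (u : E → ℝ) (x : E) : Set ℝ :=
  extension φ u x '' Set.Ioi 0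

/-- The maximal function `u*(x) = sup_{t > 0} ũ(x, t)`. -/
def maximal (φ : E → ℝ) (u : E → ℝ) (x : E) : ℝ :=
  sSup (extensionValues φ u x)

/-- `G` is the weak gradient of `u`: both are locally integrable and
`∫ u ∂_v η = - ∫ ⟨G, v⟩ η` for every direction `v` and every smooth compactly supported `η`.
On `E = ℝ` this says that `G` is the weak derivative of `u`. -/
def HasWeakGradient (u : E → ℝ) (G : E → E) : Prop :=
  LocallyIntegrable u ∧ LocallyIntegrable G ∧
    ∀ η : E → ℝ, ContDiff ℝ (⊤ : ℕ∞) η → HasCompactSupport η → ∀ v : E,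
      ∫ x, u x * fderiv ℝ η x v = - ∫ x, inner ℝ (G x) v * η x

/-- `u ∈ W^{1,1}(E)` with weak gradient `G`. -/
def IsW11 (u : E → ℝ) (G : E → E) : Prop :=
  Integrable u ∧ Integrable G ∧ HasWeakGradient u G

/-- The norm `‖u‖_1 + ‖G‖_1` of a function `u ∈ W^{1,1}(E)` with weak gradient `G`. -/
def normW11 (u : E → ℝ) (G : E → E) : ℝ :=
  (∫ x, |u x|) + ∫ x, ‖G x‖

end

/-- A continuous function `f` is subharmonic in the open set `Ω` if for every closed ball contained
in `Ω` and every `h` that is continuous on the closed ball, harmonic in the open ball and satisfies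
`f ≤ h` on the bounding sphere, one has `f ≤ h` in the ball. -/
def SubharmonicOn {E : Type*} [NormedAddCommGroup E] [InnerProductSpace ℝ E]
    [FiniteDimensional ℝ E] (f : E → ℝ) (Ω : Set E) : Prop :=
  IsOpen Ω ∧ ContinuousOn f Ω ∧
    ∀ (x : E) (r : ℝ), 0 < r → closedBall x r ⊆ Ω →
      ∀ h : E → ℝ, ContinuousOn h (closedBall x r) →
        InnerProductSpace.HarmonicOnNhd h (ball x r) →
        (∀ y ∈ sphere x r, f y ≤ h y) → ∀ y ∈ ball x r, f y ≤ h y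

end FracPoisson

end

/-!
Write `N = |u|`, `ũ(x, t) = (N * φ_t)(x)`, and `u* = sup_t ũ(·, t)`.

The dilated kernel is `C t^{1-α} (|z|² + t²)^{-(d+1-α)/2}`, so that `ũ` solves
`Δ_x ũ + ∂_t² ũ + (α / t) ∂_t ũ = 0` in the upper half-space. It tends to `N(x)` as `t → 0` and to
`0` as `t → ∞`; hence, where `u* > N`, the supremum over `t` is a maximum attained at a positive
time. The functions `ũ(·, t)` are equicontinuous at each point, uniformly in `t`
(`eventually_abs_extension_sub_le`), which gives the continuity of `u*`.

Subharmonicity of `u*` off the contact set `{u* = N}` follows from the second derivative test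
alone, without a strong maximum principle. If `u*` exceeded a harmonic `h` inside a ball, then
`u* - h + ε |· - x₀|²` would have an interior maximum at some `x`, and
`ũ(y, s) - h(y) + ε |y - x₀|²` a local maximum at `(x, t)`, where `t` is a time with
`ũ(x, t) = u*(x)`; but the operator above takes the value `2dε > 0` on that function
(`sum_nonneg_of_isLocalMax_extension_sub`, `subharmonicOn_maximal`).

On the line, `u` agrees almost everywhere with a primitive `w` of `u'`
(`IsW11.exists_continuous_representative`), and `u* ≥ |w|` is bounded, and convex on the intervals
inside `{u* > |w|}`. On a connected component of this set, `u*` decreases to a minimum and then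
increases, and it agrees with `|w|` at the finite endpoints (on an unbounded component it is
monotone, being bounded and convex). So its variation there is at most `∫ |u'|` over the
component. Summing over the components bounds `∫ |(u*)'|` over `{u* > |w|}` by `‖u'‖₁`. The
increments of `u*` are therefore controlled by the integrals of the single integrable function
`|u'| + 1_{u* > |w|} |(u*)'|`, which yields absolute continuity and `‖(u*)'‖₁ ≤ 2 ‖u'‖₁`
(`absolutelyContinuous_of_convexOn_off_contact`, `absolutelyContinuous_maximal`).
-/

noncomputable section

namespace FracPoisson

open Filter Topology Module

/-! ### The dilated kernels -/

section Kernel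

variable {E : Type*} [NormedAddCommGroup E] [InnerProductSpace ℝ E]

/-- The exponent `(d + 1 - α) / 2` of the profile. -/
def kernelExponent (E : Type*) [NormedAddCommGroup E] [InnerProductSpace ℝ E] (α : ℝ) : ℝ :=
  ((finrank ℝ E : ℝ) + 1 - α) / 2

lemma kernelExponent_pos {α : ℝ} (hα1 : α < 1) : 0 < kernelExponent E α := by
  have : (0 : ℝ) ≤ finrank ℝ E := Nat.cast_nonneg _
  unfold kernelExponent; linarith

lemma profile_pos (α : ℝ) (x : E) : 0 < profile E α x := by
  unfold profile; positivity

variable [MeasureSpace E]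

/-- The normalizing constant of the kernel. -/
def kernelConst (E : Type*) [NormedAddCommGroup E] [InnerProductSpace ℝ E] [MeasureSpace E]
    (α : ℝ) : ℝ :=
  (∫ y : E, profile E α y)⁻¹

lemma kernelConst_nonneg (α : ℝ) : 0 ≤ kernelConst E α :=
  inv_nonneg.2 (integral_nonneg fun x => (profile_pos α x).le)

lemma kernel_nonneg (α : ℝ) (x : E) : 0 ≤ kernel E α x :=
  mul_nonneg (kernelConst_nonneg α) (profile_pos α x).le

/-- The dilated kernel in homogeneous form: it is `t^{1-α}` times a power of the squared
distance `|z|² + t²` in one more variable. -/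
lemma dilate_kernel (α : ℝ) {t : ℝ} (ht : 0 < t) (z : E) :
    dilate (kernel E α) t z =
      kernelConst E α * t ^ (1 - α) * (‖z‖ ^ 2 + t ^ 2) ^ (-kernelExponent E α) := by
  have h1 : ‖t⁻¹ • z‖ ^ 2 + 1 = (‖z‖ ^ 2 + t ^ 2) / t ^ 2 := by
    rw [norm_smul, Real.norm_of_nonneg (by positivity)]
    field_simp
  have h2 : (t ^ 2) ^ kernelExponent E α = t ^ finrank ℝ E * t ^ (1 - α) := by
    rw [← Real.rpow_natCast t 2, ← Real.rpow_mul ht.le, ← Real.rpow_natCast t (finrank ℝ E),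
      ← Real.rpow_add ht]
    congr 1
    unfold kernelExponent
    push_cast
    ring
  have h3 : profile E α (t⁻¹ • z) =
      (t ^ 2) ^ kernelExponent E α * (‖z‖ ^ 2 + t ^ 2) ^ (-kernelExponent E α) := by
    rw [profile, h1, ← kernelExponent, Real.div_rpow (by positivity) (by positivity),
      Real.rpow_neg (by positivity)]
    field_simp
  rw [dilate, kernel, h3, h2, ← kernelConst]
  field_simp

lemma dilate_kernel_nonneg (α : ℝ) {t : ℝ} (ht : 0 < t) (z : E) :
    0 ≤ dilate (kernel E α) t z :=
  mul_nonneg (by positivity) (kernel_nonneg _ _)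

lemma continuous_dilate_kernel (α : ℝ) {t : ℝ} (ht : 0 < t) :
    Continuous (dilate (kernel E α) t) := by
  have : dilate (kernel E α) t = fun z : E =>
      kernelConst E α * t ^ (1 - α) * (‖z‖ ^ 2 + t ^ 2) ^ (-kernelExponent E α) :=
    funext fun z => dilate_kernel α ht z
  rw [this]
  refine continuous_const.mul (Continuous.rpow_const (by fun_prop) fun x => Or.inl ?_)
  positivity

/-- The dilated kernels are bounded by `C t^{-d}`. -/
lemma dilate_kernel_le {α : ℝ} (hα1 : α < 1) {t : ℝ} (ht : 0 < t) (z : E) :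
    dilate (kernel E α) t z ≤ kernelConst E α * (t ^ finrank ℝ E)⁻¹ := by
  have hp : profile E α (t⁻¹ • z) ≤ 1 := by
    rw [profile]
    apply div_le_one_of_le₀ _ (by positivity)
    exact Real.one_le_rpow (by nlinarith [sq_nonneg ‖t⁻¹ • z‖]) (kernelExponent_pos (E := E) hα1).le
  rw [dilate, kernel, ← kernelConst, one_div, mul_comm]
  have := kernelConst_nonneg (E := E) α
  exact mul_le_mul_of_nonneg_right (mul_le_of_le_one_right this hp) (by positivity)

/-- Outside the unit ball the dilated kernels are bounded uniformly in `t`. -/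
lemma dilate_kernel_le_of_one_le {α : ℝ} (hα1 : α < 1) {t : ℝ} (ht : 0 < t) {z : E}
    (hz : 1 ≤ ‖z‖) : dilate (kernel E α) t z ≤ kernelConst E α := by
  have hQ : 1 ≤ ‖z‖ ^ 2 + t ^ 2 := by nlinarith [sq_nonneg t]
  have hQ0 : 0 < ‖z‖ ^ 2 + t ^ 2 := by linarith
  have h1 : t ^ (1 - α) ≤ (‖z‖ ^ 2 + t ^ 2) ^ kernelExponent E α := by
    calc t ^ (1 - α) = (t ^ 2) ^ ((1 - α) / 2) := by
          rw [← Real.rpow_natCast t 2, ← Real.rpow_mul ht.le]; congr 1; push_cast; ring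
      _ ≤ (‖z‖ ^ 2 + t ^ 2) ^ ((1 - α) / 2) :=
          Real.rpow_le_rpow (by positivity) (by nlinarith [sq_nonneg ‖z‖]) (by linarith)
      _ ≤ _ := by
          apply Real.rpow_le_rpow_of_exponent_le hQ
          have : (0 : ℝ) ≤ finrank ℝ E := Nat.cast_nonneg _
          unfold kernelExponent; linarith
  rw [dilate_kernel α ht, mul_assoc]
  refine mul_le_of_le_one_right (kernelConst_nonneg α) ?_
  rw [Real.rpow_neg hQ0.le, ← div_eq_mul_inv]
  exact div_le_one_of_le₀ h1 (by positivity)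

lemma tendsto_norm_pow_mul_kernel {α : ℝ} (hα1 : α < 1) :
    Tendsto (fun x : E => ‖x‖ ^ finrank ℝ E * kernel E α x) (Bornology.cobounded E) (𝓝 0) := by
  have h0 : Tendsto (fun x : E => kernelConst E α * ‖x‖ ^ (-(1 - α)))
      (Bornology.cobounded E) (𝓝 0) := by
    have := (tendsto_rpow_neg_atTop (show 0 < 1 - α by linarith)).comp
      (tendsto_norm_cobounded_atTop (E := E))
    simpa using this.const_mul (kernelConst E α)
  refine squeeze_zero' (Eventually.of_forall fun x => mul_nonneg (by positivity)
    (kernel_nonneg _ _)) ?_ h0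
  filter_upwards [tendsto_norm_cobounded_atTop.eventually_ge_atTop 1] with x hx
  have hx0 : 0 < ‖x‖ := by linarith
  rw [kernel, ← kernelConst, mul_left_comm]
  refine mul_le_mul_of_nonneg_left ?_ (kernelConst_nonneg α)
  have h1 : ‖x‖ ^ (2 * kernelExponent E α) ≤ (‖x‖ ^ 2 + 1) ^ kernelExponent E α := by
    rw [Real.rpow_mul hx0.le, Real.rpow_two]
    exact Real.rpow_le_rpow (by positivity) (by linarith) (kernelExponent_pos hα1).le
  have h2 : ‖x‖ ^ (-(1 - α)) = ‖x‖ ^ finrank ℝ E / ‖x‖ ^ (2 * kernelExponent E α) := by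
    rw [← Real.rpow_natCast, ← Real.rpow_sub hx0]
    congr 1; unfold kernelExponent; ring
  rw [h2, profile, ← kernelExponent, mul_one_div]
  gcongr

variable [FiniteDimensional ℝ E] [BorelSpace E] [(volume : Measure E).IsAddHaarMeasure]

lemma integral_dilate_kernel {α : ℝ} (hα1 : α < 1) {t : ℝ} (ht : 0 < t) :
    ∫ z : E, dilate (kernel E α) t z = 1 := by
  simp only [dilate]
  rw [integral_const_mul, Measure.integral_comp_inv_smul, integral_kernel hα1, smul_eq_mul,
    mul_one, abs_of_pos (by positivity)]
  field_simp

lemma integrable_dilate_kernel {α : ℝ} (hα1 : α < 1) {t : ℝ} (ht : 0 < t) :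
    Integrable (dilate (kernel E α) t) :=
  integrable_of_integral_eq_one (integral_dilate_kernel hα1 ht)

end Kernel

/-! ### The extension: limits in `t` and equicontinuity in `x` -/

section Extension

variable {E : Type*} [NormedAddCommGroup E] [InnerProductSpace ℝ E] [MeasureSpace E]

lemma extension_def (φ u : E → ℝ) (x : E) (t : ℝ) :
    extension φ u x t = ∫ y, |u y| * dilate φ t (x - y) := by
  simp [extension, convolution_def]

/-- The extension as `t^{1-α}` times a Riesz-type potential of `|u|` in the variables `(x, t)`. -/
lemma extension_eq_potential (α : ℝ) (u : E → ℝ) (x : E) {t : ℝ} (ht : 0 < t) :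
    extension (kernel E α) u x t = kernelConst E α * t ^ (1 - α) *
      ∫ y, |u y| * (‖x - y‖ ^ 2 + t ^ 2) ^ (-kernelExponent E α) := by
  rw [extension_def, ← integral_const_mul]
  refine integral_congr_ae (Eventually.of_forall fun y => ?_)
  simp only [dilate_kernel α ht]
  ring

lemma extension_nonneg (α : ℝ) (u : E → ℝ) (x : E) {t : ℝ} (ht : 0 < t) :
    0 ≤ extension (kernel E α) u x t := by
  rw [extension_def]
  exact integral_nonneg fun y => mul_nonneg (abs_nonneg _) (dilate_kernel_nonneg α ht _)

lemma extension_congr_ae {φ u v : E → ℝ} (h : v =ᵐ[volume] u) :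
    extension φ v = extension φ u := by
  funext x t
  rw [extension_def, extension_def]
  refine integral_congr_ae ?_
  filter_upwards [h] with y hy
  rw [hy]

lemma maximal_congr_ae {φ u v : E → ℝ} (h : v =ᵐ[volume] u) : maximal φ v = maximal φ u := by
  funext x
  rw [maximal, maximal, extensionValues, extensionValues, extension_congr_ae h]

lemma maximal_le {α : ℝ} {u : E → ℝ} {x : E} {M : ℝ}
    (h : ∀ t > 0, extension (kernel E α) u x t ≤ M) :
    maximal (kernel E α) u x ≤ M := by
  refine csSup_le (Set.nonempty_Ioi.image _) ?_
  rintro _ ⟨t, ht, rfl⟩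
  exact h t ht

lemma extension_le {α : ℝ} (hα1 : α < 1) {u : E → ℝ} (hu : Integrable u) (x : E) {t : ℝ}
    (ht : 0 < t) :
    extension (kernel E α) u x t ≤
      kernelConst E α * (t ^ finrank ℝ E)⁻¹ * ∫ y, |u y| := by
  rw [extension_def, mul_comm, ← integral_mul_const]
  refine integral_mono_of_nonneg (Eventually.of_forall fun y => ?_) (hu.abs.mul_const _)
    (Eventually.of_forall fun y => ?_)
  · exact mul_nonneg (abs_nonneg _) (dilate_kernel_nonneg α ht _)
  · exact mul_le_mul_of_nonneg_left (dilate_kernel_le hα1 ht _) (abs_nonneg _)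

variable [FiniteDimensional ℝ E]

lemma tendsto_extension_atTop [Nontrivial E] {α : ℝ} (hα1 : α < 1) {u : E → ℝ}
    (hu : Integrable u) (x : E) :
    Tendsto (extension (kernel E α) u x) atTop (𝓝 0) := by
  have h0 : Tendsto (fun t : ℝ => kernelConst E α * (t ^ finrank ℝ E)⁻¹ * ∫ y, |u y|)
      atTop (𝓝 0) := by
    have := (tendsto_pow_neg_atTop (𝕜 := ℝ) (finrank_pos (R := ℝ) (M := E)).ne')
    have h := (this.const_mul (kernelConst E α)).mul_const (∫ y, |u y|)
    simpa using h
  refine squeeze_zero' ?_ ?_ h0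
  · filter_upwards [eventually_gt_atTop 0] with t ht using extension_nonneg α u x ht
  · filter_upwards [eventually_gt_atTop 0] with t ht using extension_le hα1 hu x ht

variable [BorelSpace E] [(volume : Measure E).IsAddHaarMeasure]

/-- The dilated kernels form an approximate identity. -/
lemma tendsto_extension_zero {α : ℝ} (hα1 : α < 1) {u : E → ℝ}
    (hu : Integrable u) {x : E} (hx : ContinuousAt u x) :
    Tendsto (extension (kernel E α) u x) (𝓝[>] 0) (𝓝 |u x|) := by
  have h := (tendsto_integral_comp_smul_smul_of_integrable' (μ := (volume : Measure E))
    (kernel_nonneg (E := E) α) (integral_kernel hα1) (tendsto_norm_pow_mul_kernel hα1)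
    hu.abs hx.abs).comp tendsto_inv_nhdsGT_zero
  refine h.congr fun t => ?_
  rw [extension_def]
  simp only [Function.comp, dilate, smul_eq_mul]
  refine integral_congr_ae (Eventually.of_forall fun y => ?_)
  simp only [one_div, inv_pow]
  ring

lemma extension_eq_translate (φ u : E → ℝ) (x : E) (t : ℝ) :
    extension φ u x t = ∫ z, |u (x - z)| * dilate φ t z := by
  rw [extension_def, ← integral_sub_left_eq_self _ volume x]
  simp

lemma integrable_comp_sub_left_mul_dilate {α : ℝ} (hα1 : α < 1) {u : E → ℝ} (hu : Integrable u)
    (x : E) {t : ℝ} (ht : 0 < t) :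
    Integrable fun z => |u (x - z)| * dilate (kernel E α) t z := by
  refine (hu.abs.comp_sub_left x).mul_bdd (c := kernelConst E α * (t ^ finrank ℝ E)⁻¹)
    (continuous_dilate_kernel α ht).aestronglyMeasurable (Eventually.of_forall fun z => ?_)
  rw [Real.norm_of_nonneg (dilate_kernel_nonneg α ht z)]
  exact dilate_kernel_le hα1 ht z

/-- Continuity of translations in `L¹`. -/
lemma tendsto_integral_abs_translate_sub {w : E → ℝ} (hw : Integrable w) (x : E) :
    Tendsto (fun y : E => ∫ z, |w (y - z) - w (x - z)|) (𝓝 x) (𝓝 0) := by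
  let g : E → C(E, E) := fun y => ⟨fun z => y - z, by fun_prop⟩
  have hgm : ∀ y, MeasurePreserving (g y) (volume : Measure E) volume :=
    fun y => Measure.measurePreserving_sub_left volume y
  have hg : Continuous g :=
    ContinuousMap.continuous_of_continuous_uncurry _
      (show Continuous fun p : E × E => p.1 - p.2 by fun_prop)
  have hT := ((tendsto_const_nhds (x := hw.toL1 w)).compMeasurePreservingLp
    (hg.tendsto x) hgm (hgm x) ENNReal.one_ne_top)
  have h2 := (tendsto_iff_norm_sub_tendsto_zero.1 hT)
  refine h2.congr fun y => ?_
  have e : ∀ y, Lp.compMeasurePreserving (g y) (hgm y) (hw.toL1 w) =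
      (hw.comp_sub_left y).toL1 (fun z => w (y - z)) := fun y => by
    unfold Integrable.toL1
    rw [Lp.toLp_compMeasurePreserving]
    rfl
  rw [e, e, ← Integrable.toL1_sub, L1.norm_of_fun_eq_integral_norm]
  rfl

/-- The functions `ũ(·, t)`, `t > 0`, are equicontinuous at every point: near the origin the
kernel is integrated against the uniformly small oscillation of `u`, away from the origin it is
bounded uniformly in `t` and translations are continuous in `L¹`. -/
lemma eventually_abs_extension_sub_le {α : ℝ} (hα1 : α < 1) {u : E → ℝ} (hu : Integrable u)
    (huc : Continuous u) (x : E) {ε : ℝ} (hε : 0 < ε) :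
    ∀ᶠ y in 𝓝 x, ∀ t > 0,
      |extension (kernel E α) u y t - extension (kernel E α) u x t| ≤ ε := by
  have hc := kernelConst_nonneg (E := E) α
  -- uniform smallness on the unit ball
  have h1 : ∀ᶠ y in 𝓝 x, ∀ z ∈ closedBall (0 : E) 1, dist |u (x - z)| |u (y - z)| < ε / 2 := by
    let g : E → C(E, ℝ) := fun y => ⟨fun z => |u (y - z)|, by fun_prop⟩
    have hg : Continuous g := ContinuousMap.continuous_of_continuous_uncurry _
      (show Continuous fun p : E × E => |u (p.1 - p.2)| by fun_prop)
    have := ContinuousMap.tendsto_iff_forall_isCompact_tendstoUniformlyOn.1 (hg.tendsto x) _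
      (isCompact_closedBall (0 : E) 1)
    exact Metric.tendstoUniformlyOn_iff.1 this (ε / 2) (by positivity)
  have h2 : ∀ᶠ y in 𝓝 x, kernelConst E α * ∫ z, |(|u (y - z)| - |u (x - z)|)| < ε / 2 := by
    have := (tendsto_integral_abs_translate_sub hu.abs x).const_mul (kernelConst E α)
    rw [mul_zero] at this
    exact this.eventually_lt_const (by positivity)
  filter_upwards [h1, h2] with y hy1 hy2 t ht
  have hI : Integrable fun z => |u (y - z)| - |u (x - z)| :=
    (hu.abs.comp_sub_left y).sub (hu.abs.comp_sub_left x)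
  rw [extension_eq_translate, extension_eq_translate, ← integral_sub
    (integrable_comp_sub_left_mul_dilate hα1 hu y ht)
    (integrable_comp_sub_left_mul_dilate hα1 hu x ht)]
  calc _ ≤ ∫ z, |(|u (y - z)| * dilate (kernel E α) t z - |u (x - z)| * dilate (kernel E α) t z)| :=
        abs_integral_le_integral_abs
    _ ≤ ∫ z, (ε / 2 * dilate (kernel E α) t z +
          kernelConst E α * |(|u (y - z)| - |u (x - z)|)|) := by
        refine integral_mono_of_nonneg (Eventually.of_forall fun z => abs_nonneg _)
          (((integrable_dilate_kernel hα1 ht).const_mul _).add (hI.abs.const_mul _))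
          (Eventually.of_forall fun z => ?_)
        have hd := dilate_kernel_nonneg α ht z
        simp only
        rw [← sub_mul, abs_mul, abs_of_nonneg hd]
        have hA := abs_nonneg (|u (y - z)| - |u (x - z)|)
        rcases le_total ‖z‖ 1 with hz | hz
        · have := hy1 z (by simpa using hz)
          rw [dist_comm, Real.dist_eq] at this
          nlinarith [mul_le_mul_of_nonneg_right this.le hd, mul_nonneg hc hA]
        · have := dilate_kernel_le_of_one_le hα1 ht hz
          nlinarith [mul_le_mul_of_nonneg_left this hA]
    _ = ε / 2 + kernelConst E α * ∫ z, |(|u (y - z)| - |u (x - z)|)| := by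
        rw [integral_add ((integrable_dilate_kernel hα1 ht).const_mul _) (hI.abs.const_mul _),
          integral_const_mul, integral_const_mul, integral_dilate_kernel hα1 ht, mul_one]
    _ ≤ ε := by linarith

end Extension

/-! ### Derivatives of potentials along lines -/

section Potential

variable {X : Type*} [MeasurableSpace X] {μ : Measure X}

/-- First and second derivative of a potential `∫ N Q_s^{-β}` along a line, when the squared
distance `Q_s = a + 2 b s + s²` stays bounded below. The condition `(b + s)² ≤ Q_s` says that the
distance is at least its component along the line; it makes the derivatives bounded. -/
lemma hasDerivAt_potential {N a b : X → ℝ} (hN : Integrable N μ) (ha : AEStronglyMeasurable a μ)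
    (hb : AEStronglyMeasurable b μ) {β c δ : ℝ} (hβ : 0 < β) (hc : 0 < c)
    (hQ : ∀ s ∈ ball (0 : ℝ) δ, ∀ y, c ≤ a y + 2 * b y * s + s ^ 2)
    (hbQ : ∀ s y, (b y + s) ^ 2 ≤ a y + 2 * b y * s + s ^ 2)
    {s : ℝ} (hs : s ∈ ball (0 : ℝ) δ) :
    HasDerivAt (fun s => ∫ y, N y * (a y + 2 * b y * s + s ^ 2) ^ (-β) ∂μ)
      (∫ y, N y * (-2 * β * (b y + s) * (a y + 2 * b y * s + s ^ 2) ^ (-β - 1)) ∂μ) s ∧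
    HasDerivAt
      (fun s => ∫ y, N y * (-2 * β * (b y + s) * (a y + 2 * b y * s + s ^ 2) ^ (-β - 1)) ∂μ)
      (∫ y, N y * (-2 * β * (a y + 2 * b y * s + s ^ 2) ^ (-β - 1) +
        4 * β * (β + 1) * (b y + s) ^ 2 * (a y + 2 * b y * s + s ^ 2) ^ (-β - 2)) ∂μ) s ∧
    Integrable (fun y => N y * (-2 * β * (b y + s) *
      (a y + 2 * b y * s + s ^ 2) ^ (-β - 1))) μ ∧
    Integrable (fun y => N y * (-2 * β * (a y + 2 * b y * s + s ^ 2) ^ (-β - 1) +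
      4 * β * (β + 1) * (b y + s) ^ 2 * (a y + 2 * b y * s + s ^ 2) ^ (-β - 2))) μ := by
  have hball : ball (0 : ℝ) δ ∈ 𝓝 s := isOpen_ball.mem_nhds hs
  have hpos : ∀ s ∈ ball (0 : ℝ) δ, ∀ y, 0 < a y + 2 * b y * s + s ^ 2 :=
    fun s hs y => hc.trans_le (hQ s hs y)
  have hQm : ∀ s, AEMeasurable (fun y => a y + 2 * b y * s + s ^ 2) μ := fun s => by
    have := ha.aemeasurable; have := hb.aemeasurable
    fun_prop
  have hpm : ∀ s γ : ℝ, AEStronglyMeasurable (fun y => (a y + 2 * b y * s + s ^ 2) ^ γ) μ :=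
    fun s γ => ((hQm s).pow_const γ).aestronglyMeasurable
  have hle : ∀ s ∈ ball (0 : ℝ) δ, ∀ y, ∀ γ ≤ (0 : ℝ),
      (a y + 2 * b y * s + s ^ 2) ^ γ ≤ c ^ γ := fun s hs y γ hγ =>
    Real.rpow_le_rpow_of_nonpos hc (hQ s hs y) hγ
  have hdQ : ∀ y s, HasDerivAt (fun s => a y + 2 * b y * s + s ^ 2) (2 * (b y + s)) s :=
    fun y s => by
    have h1 := ((hasDerivAt_id s).const_mul (2 * b y)).const_add (a y)
    have h2 := h1.add ((hasDerivAt_id s).pow 2)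
    convert! h2 using 1
    simp; ring
  have hb2 : ∀ s, AEStronglyMeasurable (fun y => b y + s) μ :=
    fun s => hb.add aestronglyMeasurable_const
  have hm1 : ∀ s, AEStronglyMeasurable
      (fun y => N y * (-2 * β * (b y + s) * (a y + 2 * b y * s + s ^ 2) ^ (-β - 1))) μ :=
    fun s => hN.1.mul (((hb2 s).const_mul (-2 * β)).mul (hpm s _))
  have hm2 : AEStronglyMeasurable
      (fun y => N y * (-2 * β * (a y + 2 * b y * s + s ^ 2) ^ (-β - 1) +
        4 * β * (β + 1) * (b y + s) ^ 2 * (a y + 2 * b y * s + s ^ 2) ^ (-β - 2))) μ :=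
    hN.1.mul (((hpm s _).const_mul (-2 * β)).add
      ((((hb2 s).pow 2).const_mul (4 * β * (β + 1))).mul (hpm s _)))
  -- bound of the first derivative, from `|b + s| ≤ 1 + (b + s)² ≤ 1 + Q`
  have hB1 : ∀ y, ∀ s ∈ ball (0 : ℝ) δ,
      ‖N y * (-2 * β * (b y + s) * (a y + 2 * b y * s + s ^ 2) ^ (-β - 1))‖ ≤
        |N y| * (2 * β * (c ^ (-β - 1) + c ^ (-β))) := fun y s hs => by
    have h0 := hpos s hs y
    have e : (a y + 2 * b y * s + s ^ 2) * (a y + 2 * b y * s + s ^ 2) ^ (-β - 1) =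
        (a y + 2 * b y * s + s ^ 2) ^ (-β) := by
      rw [← Real.rpow_one_add' h0.le (by linarith)]; congr 1; ring
    have h1 := hle s hs y (-β - 1) (by linarith)
    have h2 := hle s hs y (-β) (by linarith)
    have hq := Real.rpow_nonneg h0.le (-β - 1)
    have habs : |b y + s| ≤ 1 + (a y + 2 * b y * s + s ^ 2) := by
      have := hbQ s y
      rw [← sq_abs] at this
      nlinarith [sq_nonneg (|b y + s| - 1)]
    rw [norm_mul, Real.norm_eq_abs, Real.norm_eq_abs, abs_mul, abs_mul, abs_mul, abs_of_nonneg hq,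
      abs_of_pos hβ, show |(-2 : ℝ)| = 2 by norm_num, mul_assoc (2 * β)]
    have h3 := mul_le_mul_of_nonneg_right habs hq
    rw [add_mul, one_mul, e] at h3
    have : |b y + s| * (a y + 2 * b y * s + s ^ 2) ^ (-β - 1) ≤ c ^ (-β - 1) + c ^ (-β) := by
      linarith
    gcongr
  have hB2 : ∀ y, ∀ s ∈ ball (0 : ℝ) δ,
      ‖N y * (-2 * β * (a y + 2 * b y * s + s ^ 2) ^ (-β - 1) +
        4 * β * (β + 1) * (b y + s) ^ 2 * (a y + 2 * b y * s + s ^ 2) ^ (-β - 2))‖ ≤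
        |N y| * ((2 * β + 4 * β * (β + 1)) * c ^ (-β - 1)) := fun y s hs => by
    have h0 := hpos s hs y
    have e : (a y + 2 * b y * s + s ^ 2) * (a y + 2 * b y * s + s ^ 2) ^ (-β - 2) =
        (a y + 2 * b y * s + s ^ 2) ^ (-β - 1) := by
      rw [← Real.rpow_one_add' h0.le (by linarith)]; congr 1; ring
    have h1 := hle s hs y (-β - 1) (by linarith)
    have hq := Real.rpow_nonneg h0.le (-β - 1)
    have hq2 := Real.rpow_nonneg h0.le (-β - 2)
    have h3 := mul_le_mul_of_nonneg_right (hbQ s y) hq2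
    rw [e] at h3
    have h4 : 0 ≤ (b y + s) ^ 2 * (a y + 2 * b y * s + s ^ 2) ^ (-β - 2) := by positivity
    have hβ2 : 0 < 4 * β * (β + 1) := by positivity
    rw [norm_mul, Real.norm_eq_abs, Real.norm_eq_abs]
    refine mul_le_mul_of_nonneg_left ?_ (abs_nonneg _)
    have h5 := mul_le_mul_of_nonneg_left (h3.trans h1) hβ2.le
    have h6 := mul_le_mul_of_nonneg_left h1 hβ.le
    have h7 := mul_nonneg hβ2.le h4
    have h8 := mul_nonneg hβ.le hq
    have h9 := mul_nonneg hβ.le (Real.rpow_nonneg hc.le (-β - 1))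
    have h10 := mul_nonneg hβ2.le (Real.rpow_nonneg hc.le (-β - 1))
    rw [abs_le]
    constructor <;> nlinarith
  have hI0 : Integrable (fun y => N y * (a y + 2 * b y * s + s ^ 2) ^ (-β)) μ :=
    hN.mul_bdd (c := c ^ (-β)) (hpm s _) (Eventually.of_forall fun y => by
      rw [Real.norm_of_nonneg (Real.rpow_nonneg (hpos s hs y).le _)]
      exact hle s hs y _ (by linarith))
  have hI1 : Integrable
      (fun y => N y * (-2 * β * (b y + s) * (a y + 2 * b y * s + s ^ 2) ^ (-β - 1))) μ :=
    (hN.abs.mul_const _).mono' (hm1 s) (Eventually.of_forall fun y => hB1 y s hs)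
  refine ⟨?_, ?_, hI1, ?_⟩
  · refine (hasDerivAt_integral_of_dominated_loc_of_deriv_le hball
      (Eventually.of_forall fun s => hN.1.mul (hpm s _)) hI0 (hm1 s)
      (Eventually.of_forall hB1) (hN.abs.mul_const _)
      (Eventually.of_forall fun y s hs => ?_)).2
    have := ((hdQ y s).rpow_const (p := -β) (Or.inl (hpos s hs y).ne')).const_mul (N y)
    convert! this using 1
    ring
  · refine (hasDerivAt_integral_of_dominated_loc_of_deriv_le hball
      (Eventually.of_forall fun s => hm1 s) hI1 hm2
      (Eventually.of_forall hB2) (hN.abs.mul_const _)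
      (Eventually.of_forall fun y s hs => ?_)).2
    have h1 := (hdQ y s).rpow_const (p := -β - 1) (Or.inl (hpos s hs y).ne')
    have h2 := ((hasDerivAt_id s).const_add (b y)).const_mul (-2 * β)
    have := (h2.mul h1).const_mul (N y)
    convert! this using 1
    simp only [id]
    rw [show -β - 1 - 1 = -β - 2 by ring]
    ring
  · exact (hN.abs.mul_const _).mono' hm2 (Eventually.of_forall fun y => hB2 y s hs)

end Potential

/-- Second-order necessary condition at a local maximum. -/
lemma nonpos_of_isLocalMax_of_hasDerivAt {f f' : ℝ → ℝ} {c x : ℝ}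
    (hf : ∀ᶠ s in 𝓝 x, HasDerivAt f (f' s) s) (hf' : HasDerivAt f' c x) (hmax : IsLocalMax f x) :
    f' x = 0 ∧ c ≤ 0 := by
  have h0 : f' x = 0 := hmax.hasDerivAt_eq_zero hf.self_of_nhds
  refine ⟨h0, ?_⟩
  by_contra! hc
  have hd : deriv f =ᶠ[𝓝 x] f' := hf.mono fun s hs => hs.deriv
  have hmin : IsLocalMin f x := isLocalMin_of_deriv_deriv_pos
    (by rw [hd.deriv_eq, hf'.deriv]; exact hc) (by rw [hd.self_of_nhds, h0])
    hf.self_of_nhds.continuousAt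
  -- a local minimum that is a local maximum is locally constant
  have hconst : f =ᶠ[𝓝 x] fun _ => f x := by
    filter_upwards [hmin, hmax] with y h1 h2 using le_antisymm h2 h1
  have : deriv (deriv f) x = 0 := by
    rw [hconst.deriv.deriv_eq]; simp
  rw [hd.deriv_eq, hf'.deriv] at this
  linarith

/-! ### The elliptic equation for the extension -/

section Touching

variable {E : Type*} [NormedAddCommGroup E] [InnerProductSpace ℝ E]

lemma norm_add_smul_sub_sq {x y e : E} (he : ‖e‖ = 1) (s : ℝ) :
    ‖x + s • e - y‖ ^ 2 = ‖x - y‖ ^ 2 + 2 * inner ℝ (x - y) e * s + s ^ 2 := by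
  rw [show x + s • e - y = (x - y) + s • e by abel, norm_add_sq_real, inner_smul_right, norm_smul,
    he, mul_one, Real.norm_eq_abs, sq_abs]
  ring

lemma inner_sub_sq_le {x y e : E} (he : ‖e‖ = 1) : inner ℝ (x - y) e ^ 2 ≤ ‖x - y‖ ^ 2 := by
  have := abs_real_inner_le_norm (x - y) e
  rw [he, mul_one] at this
  rw [← sq_abs]
  exact pow_le_pow_left₀ (abs_nonneg _) this 2

variable [MeasureSpace E] [BorelSpace E]

/-- The potential `∫ |u| (|x - y|² + t²)^{-β}` along a line in a horizontal unit direction. -/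
lemma hasDerivAt_potential_horizontal {α : ℝ} (hα1 : α < 1) {u : E → ℝ} (hu : Integrable u)
    (x : E) {t : ℝ} (ht : 0 < t) {e : E} (he : ‖e‖ = 1) :
    ∃ P' : ℝ → ℝ, (∀ᶠ s in 𝓝 0, HasDerivAt (fun s : ℝ =>
        ∫ y, |u y| * (‖x + s • e - y‖ ^ 2 + t ^ 2) ^ (-kernelExponent E α)) (P' s) s) ∧
      HasDerivAt P' (∫ y, |u y| * (-2 * kernelExponent E α *
          (‖x - y‖ ^ 2 + t ^ 2) ^ (-kernelExponent E α - 1) +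
        4 * kernelExponent E α * (kernelExponent E α + 1) * inner ℝ (x - y) e ^ 2 *
          (‖x - y‖ ^ 2 + t ^ 2) ^ (-kernelExponent E α - 2))) 0 ∧
      Integrable (fun y => |u y| * (-2 * kernelExponent E α *
          (‖x - y‖ ^ 2 + t ^ 2) ^ (-kernelExponent E α - 1) +
        4 * kernelExponent E α * (kernelExponent E α + 1) * inner ℝ (x - y) e ^ 2 *
          (‖x - y‖ ^ 2 + t ^ 2) ^ (-kernelExponent E α - 2))) := by
  have hbm : AEStronglyMeasurable (fun y : E => inner ℝ (x - y) e) volume := by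
    have : Continuous fun y : E => inner ℝ (x - y) e := by fun_prop
    exact this.aestronglyMeasurable
  have key := fun s hs => hasDerivAt_potential (δ := 1) hu.abs
    (show Continuous fun y : E => ‖x - y‖ ^ 2 + t ^ 2 by fun_prop).aestronglyMeasurable hbm
    (kernelExponent_pos (E := E) hα1)
    (show 0 < t ^ 2 by positivity)
    (fun s _ y => by
      have := norm_add_smul_sub_sq (x := x) (y := y) he s
      nlinarith [sq_nonneg ‖x + s • e - y‖])
    (fun s y => by nlinarith [inner_sub_sq_le (x := x) (y := y) he, sq_nonneg t])
    (s := s) hs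
  have k0 := key 0 (mem_ball_self one_pos)
  refine ⟨fun s => ∫ y, |u y| * (-2 * kernelExponent E α * (inner ℝ (x - y) e + s) *
    (‖x - y‖ ^ 2 + t ^ 2 + 2 * inner ℝ (x - y) e * s + s ^ 2) ^ (-kernelExponent E α - 1)),
    ?_, ?_, ?_⟩
  rotate_left
  · have := k0.2.1
    simp only [mul_zero, add_zero, ne_eq, OfNat.ofNat_ne_zero, not_false_eq_true, zero_pow] at this
    exact this
  · have := k0.2.2.2
    simp only [mul_zero, add_zero, ne_eq, OfNat.ofNat_ne_zero, not_false_eq_true, zero_pow] at this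
    exact this
  · filter_upwards [ball_mem_nhds (0 : ℝ) one_pos] with s hs
    refine (key s hs).1.congr_of_eventuallyEq (Eventually.of_forall fun s => ?_)
    refine integral_congr_ae (Eventually.of_forall fun y => ?_)
    simp only [norm_add_smul_sub_sq he]
    ring_nf

/-- The potential `∫ |u| (|x - y|² + t²)^{-β}` along the vertical direction. -/
lemma hasDerivAt_potential_vertical {α : ℝ} (hα1 : α < 1) {u : E → ℝ} (hu : Integrable u)
    (x : E) {t : ℝ} (ht : 0 < t) :
    ∃ P' : ℝ → ℝ, (∀ᶠ s in 𝓝 0, HasDerivAt (fun s : ℝ =>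
        ∫ y, |u y| * (‖x - y‖ ^ 2 + (t + s) ^ 2) ^ (-kernelExponent E α)) (P' s) s) ∧
      P' 0 = ∫ y, |u y| * (-2 * kernelExponent E α * t *
          (‖x - y‖ ^ 2 + t ^ 2) ^ (-kernelExponent E α - 1)) ∧
      HasDerivAt P' (∫ y, |u y| * (-2 * kernelExponent E α *
          (‖x - y‖ ^ 2 + t ^ 2) ^ (-kernelExponent E α - 1) +
        4 * kernelExponent E α * (kernelExponent E α + 1) * t ^ 2 *
          (‖x - y‖ ^ 2 + t ^ 2) ^ (-kernelExponent E α - 2))) 0 ∧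
      Integrable (fun y => |u y| * (-2 * kernelExponent E α * t *
          (‖x - y‖ ^ 2 + t ^ 2) ^ (-kernelExponent E α - 1))) ∧
      Integrable (fun y => |u y| * (-2 * kernelExponent E α *
          (‖x - y‖ ^ 2 + t ^ 2) ^ (-kernelExponent E α - 1) +
        4 * kernelExponent E α * (kernelExponent E α + 1) * t ^ 2 *
          (‖x - y‖ ^ 2 + t ^ 2) ^ (-kernelExponent E α - 2))) := by
  -- on `|s| < t / 2` the height `t + s` is at least `t / 2`
  have key := fun s hs => hasDerivAt_potential (δ := t / 2) hu.abs
    (show Continuous fun y : E => ‖x - y‖ ^ 2 + t ^ 2 by fun_prop).aestronglyMeasurable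
    (b := fun _ => t) aestronglyMeasurable_const
    (kernelExponent_pos (E := E) hα1) (show 0 < (t / 2) ^ 2 by positivity)
    (fun s hs y => by
      rw [mem_ball, dist_zero_right, Real.norm_eq_abs, abs_lt] at hs
      nlinarith [sq_nonneg ‖x - y‖])
    (fun s y => by nlinarith [sq_nonneg ‖x - y‖])
    (s := s) hs
  have k0 := key 0 (mem_ball_self (by positivity))
  refine ⟨fun s => ∫ y, |u y| * (-2 * kernelExponent E α * (t + s) *
    (‖x - y‖ ^ 2 + t ^ 2 + 2 * t * s + s ^ 2) ^ (-kernelExponent E α - 1)),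
    ?_, ?_, ?_, ?_, ?_⟩
  rotate_left 2
  · have := k0.2.1
    simp only [mul_zero, add_zero, ne_eq, OfNat.ofNat_ne_zero, not_false_eq_true, zero_pow] at this
    exact this
  · have := k0.2.2.1
    simp only [mul_zero, add_zero, ne_eq, OfNat.ofNat_ne_zero, not_false_eq_true, zero_pow] at this
    exact this
  · have := k0.2.2.2
    simp only [mul_zero, add_zero, ne_eq, OfNat.ofNat_ne_zero, not_false_eq_true, zero_pow] at this
    exact this
  · filter_upwards [ball_mem_nhds (0 : ℝ) (half_pos ht)] with s hs
    refine (key s hs).1.congr_of_eventuallyEq (Eventually.of_forall fun s => ?_)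
    refine integral_congr_ae (Eventually.of_forall fun y => ?_)
    simp only
    ring_nf
  · simp

lemma continuousOn_extension {α : ℝ} (hα1 : α < 1) {u : E → ℝ} (hu : Integrable u) (x : E) :
    ContinuousOn (extension (kernel E α) u x) (Set.Ioi 0) := by
  intro t ht
  apply ContinuousAt.continuousWithinAt
  obtain ⟨P', hP, -⟩ := hasDerivAt_potential_vertical hα1 hu x ht
  have h1 : ContinuousAt (fun s : ℝ =>
      ∫ y, |u y| * (‖x - y‖ ^ 2 + s ^ 2) ^ (-kernelExponent E α)) t := by
    have h2 := hP.self_of_nhds.continuousAt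
    rw [← sub_self t] at h2
    have h3 := h2.comp (f := fun r => r - t) (by fun_prop)
    simpa [Function.comp_def] using h3
  have h4 : ContinuousAt (fun s : ℝ => kernelConst E α * s ^ (1 - α) *
      ∫ y, |u y| * (‖x - y‖ ^ 2 + s ^ 2) ^ (-kernelExponent E α)) t :=
    (continuousAt_const.mul (Real.continuousAt_rpow_const _ _ (Or.inl (ne_of_gt ht)))).mul h1
  refine h4.congr ?_
  filter_upwards [lt_mem_nhds ht] with s hs
  rw [extension_eq_potential α u x hs]

/-- Viscosity form of the equation `Δ_x ũ + ∂_t² ũ + (α / t) ∂_t ũ = 0`: a function of `x` alone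
that touches `ũ` from above, up to a constant, at a point of the upper half-space has nonnegative
Laplacian there. The Laplacian enters as the sum of the second derivatives `g'' i` along an
orthonormal basis. -/
lemma sum_nonneg_of_isLocalMax_extension_sub {α : ℝ} (hα1 : α < 1) {u : E → ℝ}
    (hu : Integrable u) {x : E} {t : ℝ} (ht : 0 < t) {h : E → ℝ}
    (hmax : IsLocalMax (fun p : E × ℝ => extension (kernel E α) u p.1 p.2 - h p.1) (x, t))
    {ι : Type*} [Fintype ι] (e : OrthonormalBasis ι ℝ E) {g' : ι → ℝ → ℝ} {g'' : ι → ℝ}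
    (hg : ∀ i, ∀ᶠ s in 𝓝 0, HasDerivAt (fun s : ℝ => h (x + s • e i)) (g' i s) s)
    (hg' : ∀ i, HasDerivAt (g' i) (g'' i) 0) :
    0 ≤ ∑ i, g'' i := by
  set β := kernelExponent E α with hβ
  set A : ι → ℝ := fun i => ∫ y, |u y| * (-2 * β * (‖x - y‖ ^ 2 + t ^ 2) ^ (-β - 1) +
        4 * β * (β + 1) * inner ℝ (x - y) (e i) ^ 2 * (‖x - y‖ ^ 2 + t ^ 2) ^ (-β - 2)) with hA
  -- horizontal directions
  have hor : ∀ i, kernelConst E α * t ^ (1 - α) * A i - g'' i ≤ 0 := fun i => by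
    obtain ⟨P', hP, hP', -⟩ := hasDerivAt_potential_horizontal hα1 hu x ht (e.norm_eq_one i)
    refine (nonpos_of_isLocalMax_of_hasDerivAt (x := 0)
      (f := fun s : ℝ => kernelConst E α * t ^ (1 - α) *
        (∫ y, |u y| * (‖x + s • e i - y‖ ^ 2 + t ^ 2) ^ (-β)) - h (x + s • e i))
      (f' := fun s => kernelConst E α * t ^ (1 - α) * P' s - g' i s) ?_ ?_ ?_).2
    · filter_upwards [hP, hg i] with s h1 h2 using (h1.const_mul _).sub h2
    · exact (hP'.const_mul _).sub (hg' i)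
    · have hc : Tendsto (fun s : ℝ => (x + s • e i, t)) (𝓝 0) (𝓝 (x, t)) := by
        have : Continuous fun s : ℝ => (x + s • e i, t) := by fun_prop
        simpa using this.tendsto 0
      have := hc.eventually hmax
      filter_upwards [this] with s hs
      simp only [extension_eq_potential α u _ ht] at hs
      simpa using hs
  -- vertical direction
  obtain ⟨T', hT, hT0, hT', hI1, hI2⟩ := hasDerivAt_potential_vertical hα1 hu x ht
  set T : ℝ → ℝ := fun s => ∫ y, |u y| * (‖x - y‖ ^ 2 + (t + s) ^ 2) ^ (-β) with hTdef
  set T2 : ℝ := ∫ y, |u y| * (-2 * β * (‖x - y‖ ^ 2 + t ^ 2) ^ (-β - 1) +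
        4 * β * (β + 1) * t ^ 2 * (‖x - y‖ ^ 2 + t ^ 2) ^ (-β - 2)) with hT2
  have ver := nonpos_of_isLocalMax_of_hasDerivAt (x := 0)
      (f := fun s : ℝ => kernelConst E α * ((t + s) ^ (1 - α) * T s))
      (f' := fun s => kernelConst E α *
        ((1 - α) * (t + s) ^ (-α) * T s + (t + s) ^ (1 - α) * T' s))
      (c := kernelConst E α * ((1 - α) * (-α * t ^ (-α - 1)) * T 0 + (1 - α) * t ^ (-α) * T' 0 +
        ((1 - α) * t ^ (-α) * T' 0 + t ^ (1 - α) * T2))) ?_ ?_ ?_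
  rotate_left
  · filter_upwards [hT, lt_mem_nhds (show -t < 0 by linarith)] with s h1 h2
    have h3 : HasDerivAt (fun s => (t + s) ^ (1 - α)) ((1 - α) * (t + s) ^ (-α)) s := by
      have := ((hasDerivAt_id s).const_add t).rpow_const (p := 1 - α)
        (Or.inl (by simp only [id]; linarith))
      convert! this using 1
      simp
    exact (h3.mul h1).const_mul _
  · have h3 : ∀ p : ℝ, HasDerivAt (fun s => (t + s) ^ p) (p * t ^ (p - 1)) 0 := fun p => by
      have := ((hasDerivAt_id (0 : ℝ)).const_add t).rpow_const (p := p)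
        (Or.inl (by simpa using ht.ne'))
      convert! this using 1
      simp
    have h4 := (((h3 (-α)).const_mul (1 - α)).mul hT.self_of_nhds).add ((h3 (1 - α)).mul hT')
    have h5 := h4.const_mul (kernelConst E α)
    convert! h5 using 1
    simp
  · have hc : Tendsto (fun s : ℝ => (x, t + s)) (𝓝 0) (𝓝 (x, t)) := by
      have : Continuous fun s : ℝ => (x, t + s) := by fun_prop
      simpa using this.tendsto 0
    have := hc.eventually hmax
    filter_upwards [this, lt_mem_nhds (show -t < 0 by linarith)] with s hs h2
    simp only [extension_eq_potential α u _ ht,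
      extension_eq_potential α u _ (show 0 < t + s by linarith)] at hs
    simp only [hTdef, add_zero, ← mul_assoc]
    linarith
  obtain ⟨v1, v2⟩ := ver
  -- The potential `P` satisfies `Δ_x P + ∂_t² P + ((2 - α) / t) ∂_t P = 0`: the factor `t^{1-α}`
  -- changes the coefficient `α` into `2 - α`, and the integrand vanishes since `2β = d + 1 - α`.
  have pde : t * ∑ i, A i + (t * T2 + (2 - α) * T' 0) = 0 := by
    have hIA : ∀ i, Integrable (fun y => |u y| * (-2 * β * (‖x - y‖ ^ 2 + t ^ 2) ^ (-β - 1) +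
        4 * β * (β + 1) * inner ℝ (x - y) (e i) ^ 2 * (‖x - y‖ ^ 2 + t ^ 2) ^ (-β - 2))) :=
      fun i => by
        obtain ⟨P', -, -, hI⟩ := hasDerivAt_potential_horizontal hα1 hu x ht (e.norm_eq_one i)
        exact hI
    rw [hT0, hT2, hA, ← integral_finsetSum _ fun i _ => hIA i, ← integral_const_mul,
      ← integral_const_mul, ← integral_const_mul, ← integral_add (hI2.const_mul _)
        (hI1.const_mul _), ← integral_add ((integrable_finsetSum _ fun i _ => hIA i).const_mul _)
        ((hI2.const_mul _).fun_add (hI1.const_mul _))]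
    refine integral_eq_zero_of_ae (Eventually.of_forall fun y => ?_)
    have hQ : 0 < ‖x - y‖ ^ 2 + t ^ 2 := by positivity
    have hsum : ∑ i, inner ℝ (x - y) (e i) ^ 2 = ‖x - y‖ ^ 2 := by
      rw [← e.sum_sq_norm_inner_left (x - y)]
      simp [sq_abs]
    have hpow : (‖x - y‖ ^ 2 + t ^ 2) ^ (-β - 1) =
        (‖x - y‖ ^ 2 + t ^ 2) * (‖x - y‖ ^ 2 + t ^ 2) ^ (-β - 2) := by
      rw [← Real.rpow_one_add' hQ.le]
      · congr 1; ring
      · have := kernelExponent_pos (E := E) hα1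
        rw [← hβ] at this; linarith
    have hcard : (Fintype.card ι : ℝ) = 2 * β - 1 + α := by
      rw [hβ, kernelExponent, ← finrank_eq_card_basis e.toBasis]; ring
    simp only [← hβ, Pi.zero_apply, ← Finset.mul_sum, Finset.sum_add_distrib, Finset.sum_const,
      Finset.card_univ, nsmul_eq_mul, ← Finset.sum_mul, hcard, hsum, hpow]
    ring
  have e1 : t ^ (1 - α) = t * t ^ (-α) := by
    rw [sub_eq_add_neg, Real.rpow_add ht, Real.rpow_one]
  have e2 : t ^ (-α - 1) = t ^ (-α) / t := by rw [Real.rpow_sub ht, Real.rpow_one]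
  have hr : 0 < t ^ (-α) := Real.rpow_pos_of_pos ht _
  simp only [add_zero] at v1
  rw [e1, e2] at v2
  rw [e1] at v1
  have hsum : kernelConst E α * t ^ (1 - α) * ∑ i, A i ≤ ∑ i, g'' i := by
    rw [Finset.mul_sum]
    exact Finset.sum_le_sum fun i _ => by linarith [hor i]
  refine le_trans ?_ hsum
  rw [e1]
  have v3 : kernelConst E α * ((1 - α) * (-α * (t ^ (-α) / t)) * T 0 + (1 - α) * t ^ (-α) * T' 0 +
      ((1 - α) * t ^ (-α) * T' 0 + t * t ^ (-α) * T2)) +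
      α / t * (kernelConst E α * ((1 - α) * t ^ (-α) * T 0 + t * t ^ (-α) * T' 0)) =
      kernelConst E α * t ^ (-α) * (t * T2 + (2 - α) * T' 0) := by
    field_simp
    ring
  rw [v1] at v3
  have v4 : kernelConst E α * (t * t ^ (-α)) * ∑ i, A i =
      - (kernelConst E α * t ^ (-α) * (t * T2 + (2 - α) * T' 0)) := by
    linear_combination kernelConst E α * t ^ (-α) * pde
  rw [v4]
  linarith

end Touching

/-! ### The maximal function: continuity and subharmonicity -/

section Maximal

variable {E : Type*} [NormedAddCommGroup E] [InnerProductSpace ℝ E] [MeasureSpace E]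
  [FiniteDimensional ℝ E] [BorelSpace E] [(volume : Measure E).IsAddHaarMeasure] [Nontrivial E]
  {α : ℝ} {u : E → ℝ}

/-- A level above `|u x|` is exceeded by `ũ(x, ·)` only on a compact set of times. -/
lemma exists_Icc_extension_lt (hα1 : α < 1) (hu : Integrable u) {x : E}
    (hx : ContinuousAt u x) {m : ℝ} (hm : |u x| < m) :
    ∃ a > 0, ∃ b, ∀ t > 0, t ∉ Set.Icc a b → extension (kernel E α) u x t < m := by
  have h0 := (tendsto_extension_zero hα1 hu hx).eventually_lt_const hm
  have h1 := (tendsto_extension_atTop hα1 hu x).eventually_lt_const ((abs_nonneg _).trans_lt hm)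
  obtain ⟨a, ha, h0⟩ := mem_nhdsGT_iff_exists_Ioo_subset.1 h0
  obtain ⟨b, h1⟩ := eventually_atTop.1 h1
  refine ⟨a, ha, b, fun t ht htI => ?_⟩
  by_cases hta : t < a
  · exact h0 ⟨ht, hta⟩
  · exact h1 t (le_of_lt (not_le.1 fun h => htI ⟨not_lt.1 hta, h⟩))

lemma bddAbove_extensionValues (hα1 : α < 1) (hu : Integrable u) {x : E}
    (hx : ContinuousAt u x) : BddAbove (extensionValues (kernel E α) u x) := by
  obtain ⟨a, ha, b, h⟩ := exists_Icc_extension_lt hα1 hu hx (lt_add_one |u x|)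
  obtain ⟨M, hM⟩ := isCompact_Icc.bddAbove_image
    ((continuousOn_extension hα1 hu x).mono fun t ht => ha.trans_le (ht : t ∈ Set.Icc a b).1)
  refine ⟨max M (|u x| + 1), ?_⟩
  rintro _ ⟨t, ht, rfl⟩
  by_cases htI : t ∈ Set.Icc a b
  · exact le_max_of_le_left (hM ⟨t, htI, rfl⟩)
  · exact le_max_of_le_right (h t ht htI).le

lemma extension_le_maximal (hα1 : α < 1) (hu : Integrable u) {x : E}
    (hx : ContinuousAt u x) {t : ℝ} (ht : 0 < t) :
    extension (kernel E α) u x t ≤ maximal (kernel E α) u x :=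
  le_csSup (bddAbove_extensionValues hα1 hu hx) ⟨t, ht, rfl⟩

lemma abs_le_maximal (hα1 : α < 1) (hu : Integrable u) {x : E} (hx : ContinuousAt u x) :
    |u x| ≤ maximal (kernel E α) u x := by
  refine le_of_tendsto (tendsto_extension_zero hα1 hu hx) ?_
  filter_upwards [self_mem_nhdsWithin] with t ht using extension_le_maximal hα1 hu hx ht

/-- Where `u*` exceeds `|u|`, the supremum defining it is attained at a positive time. -/
lemma exists_extension_eq_maximal (hα1 : α < 1) (hu : Integrable u) {x : E}
    (hx : ContinuousAt u x) (hlt : |u x| < maximal (kernel E α) u x) :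
    ∃ t > 0, extension (kernel E α) u x t = maximal (kernel E α) u x := by
  obtain ⟨m, hm, hmm⟩ := exists_between hlt
  obtain ⟨a, ha, b, h⟩ := exists_Icc_extension_lt hα1 hu hx hm
  obtain ⟨_, ⟨t, ht, rfl⟩, htm⟩ := exists_lt_of_lt_csSup (Set.nonempty_Ioi.image _) hmm
  have htI : t ∈ Set.Icc a b := by
    by_contra hn
    exact lt_asymm htm (h t ht hn)
  obtain ⟨t₀, ht₀, hmax⟩ := isCompact_Icc.exists_isMaxOn ⟨t, htI⟩
    ((continuousOn_extension hα1 hu x).mono fun t ht => ha.trans_le (ht : t ∈ Set.Icc a b).1)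
  have ht₀0 : 0 < t₀ := ha.trans_le ht₀.1
  refine ⟨t₀, ht₀0, le_antisymm (extension_le_maximal hα1 hu hx ht₀0) (maximal_le fun s hs => ?_)⟩
  by_cases hsI : s ∈ Set.Icc a b
  · exact hmax hsI
  · exact ((h s hs hsI).trans htm).le.trans (hmax htI)

/-- Equicontinuity of the `ũ(·, t)` passes to their supremum. -/
lemma continuous_maximal (hα1 : α < 1) (hu : Integrable u) (huc : Continuous u) :
    Continuous (maximal (kernel E α) u) := by
  rw [continuous_iff_continuousAt]
  intro x
  rw [ContinuousAt, Metric.tendsto_nhds]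
  intro ε hε
  filter_upwards [eventually_abs_extension_sub_le hα1 hu huc x (half_pos hε)] with y hy
  rw [Real.dist_eq]
  refine lt_of_le_of_lt (abs_sub_le_iff.2 ⟨?_, ?_⟩) (half_lt_self hε)
  · rw [sub_le_iff_le_add]
    refine maximal_le fun t ht => ?_
    have := extension_le_maximal hα1 hu (huc.continuousAt (x := x)) ht
    linarith [(abs_le.1 (hy t ht)).2]
  · rw [sub_le_iff_le_add]
    refine maximal_le fun t ht => ?_
    have := extension_le_maximal hα1 hu (huc.continuousAt (x := y)) ht
    linarith [(abs_le.1 (hy t ht)).1]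

/-- Subharmonicity of `u*` off the contact set. If `u* - h` were positive inside a ball, so would
be the maximum of `u* - h + ε |· - x₀|²`, attained for small `ε` at an interior point `x`. Since
`u*(x) = ũ(x, t)` for some `t > 0`, the function `h - ε |· - x₀|²` touches `ũ` from above at
`(x, t)`, although its Laplacian is `-2dε < 0`. -/
lemma subharmonicOn_maximal (hα1 : α < 1) (hu : Integrable u) (huc : Continuous u) :
    SubharmonicOn (maximal (kernel E α) u) {x | |u x| < maximal (kernel E α) u x} := by
  have hmc := continuous_maximal hα1 hu huc
  refine ⟨isOpen_lt huc.abs hmc, hmc.continuousOn, ?_⟩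
  intro c r hr hball h hhc hharm hbd z hz
  by_contra! hlt
  set M := maximal (kernel E α) u z - h z with hM
  have hMpos : 0 < M := by linarith
  -- on the sphere the perturbation `ε |· - c|²` is then only `M / 2`
  set ε := M / (2 * r ^ 2) with hε
  have hεpos : 0 < ε := by positivity
  set w : E → ℝ := fun y => maximal (kernel E α) u y - h y + ε * ‖y - c‖ ^ 2 with hw
  have hwc : ContinuousOn w (closedBall c r) :=
    (hmc.continuousOn.sub hhc).add (Continuous.continuousOn (by fun_prop))
  obtain ⟨x, hx, hxmax⟩ := (isCompact_closedBall c r).exists_isMaxOn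
    ⟨z, ball_subset_closedBall hz⟩ hwc
  have hwz : M ≤ w x := by
    have : w z ≤ w x := hxmax (ball_subset_closedBall hz)
    have h2 : M ≤ w z := by
      simp only [hw]; nlinarith [sq_nonneg ‖z - c‖]
    linarith
  have hxb : x ∈ ball c r := by
    by_contra hxn
    have hxs : x ∈ sphere c r := by
      rw [mem_sphere]; exact le_antisymm hx (not_lt.1 hxn)
    have h1 := hbd x hxs
    have h2 : ‖x - c‖ = r := by rw [← dist_eq_norm]; exact hxs
    have h3 : w x ≤ ε * r ^ 2 := by simp only [hw, h2]; linarith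
    have h4 : ε * r ^ 2 = M / 2 := by rw [hε]; field_simp
    linarith
  obtain ⟨t, ht, htx⟩ := exists_extension_eq_maximal hα1 hu huc.continuousAt (hball hx)
  have hmax : IsLocalMax (fun p : E × ℝ => extension (kernel E α) u p.1 p.2 -
      (h p.1 - ε * ‖p.1 - c‖ ^ 2)) (x, t) := by
    have : ball c r ×ˢ Set.Ioi (0 : ℝ) ∈ 𝓝 (x, t) :=
      prod_mem_nhds (isOpen_ball.mem_nhds hxb) (lt_mem_nhds ht)
    filter_upwards [this] with p hp
    have h1 := extension_le_maximal hα1 hu (huc.continuousAt (x := p.1)) hp.2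
    have h2 : w p.1 ≤ w x := hxmax (ball_subset_closedBall hp.1)
    simp only [hw] at h2
    simp only [htx]
    linarith
  obtain ⟨hC2, hlap⟩ := hharm x hxb
  have e := stdOrthonormalBasis ℝ E
  have hline : ∀ i (s : ℝ), HasDerivAt (fun s : ℝ => x + s • e i) (e i) s := fun i s => by
    simpa using ((hasDerivAt_id s).smul_const (e i)).const_add x
  have hev : ∀ᶠ y in 𝓝 x, DifferentiableAt ℝ h y :=
    (hC2.eventually (by simp)).mono fun y hy => hy.differentiableAt (by simp)
  have hC1 : DifferentiableAt ℝ (fderiv ℝ h) x :=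
    (hC2.fderiv_right (m := 1) (by norm_num)).differentiableAt (by simp)
  have key := sum_nonneg_of_isLocalMax_extension_sub hα1 hu (x := x) ht
    (h := fun y => h y - ε * ‖y - c‖ ^ 2) hmax e
    (g' := fun i s => fderiv ℝ h (x + s • e i) (e i) - ε * (2 * inner ℝ (x - c) (e i) + 2 * s))
    (g'' := fun i => fderiv ℝ (fderiv ℝ h) x (e i) (e i) - ε * 2) ?_ ?_
  · have hL := hlap.self_of_nhds
    rw [InnerProductSpace.laplacian_eq_iteratedFDeriv_orthonormalBasis h e] at hL
    simp only [iteratedFDeriv_two_apply, Matrix.cons_val_zero, Matrix.cons_val_one,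
      Pi.zero_apply] at hL
    rw [Finset.sum_sub_distrib, hL, Finset.sum_const, Finset.card_univ, Fintype.card_fin,
      nsmul_eq_mul] at key
    have hd : (0 : ℝ) < finrank ℝ E := Nat.cast_pos.2 finrank_pos
    nlinarith [mul_pos hd hεpos]
  · intro i
    have ht0 : Tendsto (fun s : ℝ => x + s • e i) (𝓝 0) (𝓝 x) := by
      simpa using (hline i 0).continuousAt.tendsto
    filter_upwards [ht0.eventually hev] with s hs
    have h1 := hs.hasFDerivAt.comp_hasDerivAt s (hline i s)
    have h2 : HasDerivAt (fun s : ℝ => ‖x + s • e i - c‖ ^ 2)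
        (2 * inner ℝ (x - c) (e i) + 2 * s) s := by
      simp only [norm_add_smul_sub_sq (e.norm_eq_one i)]
      have := (((hasDerivAt_id s).const_mul (2 * inner ℝ (x - c) (e i))).const_add
        (‖x - c‖ ^ 2)).add ((hasDerivAt_id s).pow 2)
      convert! this using 1
      simp
    exact h1.sub (h2.const_mul ε)
  · intro i
    have h1 : HasDerivAt (fun s : ℝ => fderiv ℝ h (x + s • e i))
        (fderiv ℝ (fderiv ℝ h) x (e i)) 0 := by
      have h0 : HasFDerivAt (fderiv ℝ h) (fderiv ℝ (fderiv ℝ h) x) (x + (0 : ℝ) • e i) := by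
        simpa using hC1.hasFDerivAt
      exact h0.comp_hasDerivAt (0 : ℝ) (hline i 0)
    have h2 := h1.clm_apply (hasDerivAt_const (0 : ℝ) (e i))
    have h3 := (((hasDerivAt_id (0 : ℝ)).const_mul 2).const_add
      (2 * inner ℝ (x - c) (e i))).const_mul ε
    convert! h2.sub h3 using 1
    simp

end Maximal

open Set

/-! ### Absolute continuity and one-dimensional convexity -/

section AbsolutelyContinuous

/-- A function dominated by an absolutely continuous one is absolutely continuous. -/
lemma absolutelyContinuousOnInterval_of_dist_le {v F : ℝ → ℝ} {a b : ℝ}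
    (hF : AbsolutelyContinuousOnInterval F a b) (h : ∀ x y, dist (v x) (v y) ≤ dist (F x) (F y)) :
    AbsolutelyContinuousOnInterval v a b :=
  squeeze_zero (fun _ => Finset.sum_nonneg fun _ _ => dist_nonneg)
    (fun _ => Finset.sum_le_sum fun _ _ => h _ _) hF

lemma dist_le_dist_integral {v H : ℝ → ℝ} (hH : Integrable H)
    (h : ∀ x y, x ≤ y → |v y - v x| ≤ ∫ s in x..y, H s) (c x y : ℝ) :
    dist (v x) (v y) ≤ dist (∫ s in c..x, H s) (∫ s in c..y, H s) := by
  have key : ∀ x y, x ≤ y →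
      dist (v x) (v y) ≤ dist (∫ s in c..x, H s) (∫ s in c..y, H s) := fun x y hxy => by
    rw [dist_comm (v x), dist_comm (∫ s in c..x, H s), Real.dist_eq, Real.dist_eq,
      intervalIntegral.integral_interval_sub_left hH.intervalIntegrable hH.intervalIntegrable]
    exact (h x y hxy).trans (le_abs_self _)
  rcases le_total x y with hxy | hxy
  · exact key x y hxy
  · rw [dist_comm, dist_comm (∫ s in c..x, H s)]
    exact key y x hxy

/-- If the increments of `v` are bounded by integrals of an integrable `H`, then `v` is absolutely
continuous and `|v'| ≤ H` almost everywhere. -/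
lemma absolutelyContinuous_of_abs_sub_le_integral {v H : ℝ → ℝ} (hH : Integrable H)
    (hH0 : ∀ x, 0 ≤ H x) (h : ∀ x y, x ≤ y → |v y - v x| ≤ ∫ s in x..y, H s) :
    (∀ a b, AbsolutelyContinuousOnInterval v a b) ∧ Integrable (deriv v) ∧
      ∫ x, |deriv v x| ≤ ∫ x, H x := by
  have hd := dist_le_dist_integral hH h
  have hae : ∀ᵐ x, ‖deriv v x‖ ≤ H x := by
    filter_upwards [LocallyIntegrable.ae_hasDerivAt_integral hH.locallyIntegrable] with x hx
    by_cases hv : DifferentiableAt ℝ v x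
    · have h1 := (hasDerivAt_iff_tendsto_slope.1 hv.hasDerivAt).norm
      have h2 := (hasDerivAt_iff_tendsto_slope.1 (hx 0)).norm
      rw [Real.norm_of_nonneg (hH0 x)] at h2
      refine le_of_tendsto_of_tendsto h1 h2 (Eventually.of_forall fun y => ?_)
      simp only [slope_def_field, norm_div, ← dist_eq_norm]
      exact div_le_div_of_nonneg_right (hd 0 y x) dist_nonneg
    · rw [deriv_zero_of_not_differentiableAt hv, norm_zero]
      exact hH0 x
  have hi : Integrable (deriv v) :=
    hH.mono' (measurable_deriv v).aestronglyMeasurable hae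
  refine ⟨fun a b => absolutelyContinuousOnInterval_of_dist_le
    (IntervalIntegrable.absolutelyContinuousOnInterval_intervalIntegral
      hH.intervalIntegrable left_mem_uIcc) (hd a),
    hi, integral_mono_ae hi.norm hH hae⟩

end AbsolutelyContinuous

section Convex

variable {v f : ℝ → ℝ} {Ω : Set ℝ} {B : ℝ}

/-- To the left of `m`, a function that is bounded above and convex on the intervals inside an open
set `Ω` stays below its larger value at `m` or at the first point outside `Ω`. -/
lemma le_or_exists_left (hv : Continuous v) (hB : ∀ x, v x ≤ B) (hΩ : IsOpen Ω)
    (hconv : ∀ p q, Icc p q ⊆ Ω → ConvexOn ℝ (Icc p q) v) {p m : ℝ} (hpm : p ≤ m)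
    (hsub : Icc p m ⊆ Ω) :
    v p ≤ v m ∨ ∃ a < p, a ∉ Ω ∧ Ioc a m ⊆ Ω ∧ v p ≤ v a := by
  by_contra! hcon
  obtain ⟨hlt, hcon⟩ := hcon
  have hpm' : p < m := lt_of_le_of_ne hpm fun h => by rw [h] at hlt; exact lt_irrefl _ hlt
  by_cases hne : (Ωᶜ ∩ Iic p).Nonempty
  · set a := sSup (Ωᶜ ∩ Iic p) with ha
    have hbdd : BddAbove (Ωᶜ ∩ Iic p) := ⟨p, fun x hx => hx.2⟩
    have hmem : a ∈ Ωᶜ ∩ Iic p := (hΩ.isClosed_compl.inter isClosed_Iic).csSup_mem hne hbdd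
    have hpΩ : p ∈ Ω := hsub ⟨le_rfl, hpm⟩
    have hap : a < p := lt_of_le_of_ne hmem.2 fun h => hmem.1 (h ▸ hpΩ)
    have hIoc : Ioc a m ⊆ Ω := fun x hx => by
      by_cases hxp : p ≤ x
      · exact hsub ⟨hxp, hx.2⟩
      · by_contra hxΩ
        exact absurd (le_csSup hbdd ⟨hxΩ, (not_le.1 hxp).le⟩) (not_le.2 hx.1)
    have hva : v p ≤ v a := by
      refine ge_of_tendsto (hv.continuousAt.continuousWithinAt (s := Ioi a) (x := a)).tendsto ?_
      filter_upwards [Ioo_mem_nhdsGT hap] with y hy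
      have hc := hconv y m fun z hz => hIoc ⟨hy.1.trans_le hz.1, hz.2⟩
      have := hc.le_max_of_mem_Icc (left_mem_Icc.2 (hy.2.le.trans hpm))
        (right_mem_Icc.2 (hy.2.le.trans hpm)) ⟨hy.2.le, hpm⟩
      exact (le_max_iff.1 this).resolve_right (not_le.2 hlt)
    exact absurd hva (not_le.2 (hcon a hap hmem.1 hIoc))
  · -- `v` is convex on the half-line, and a decreasing convex function is unbounded there
    have hIic : Iic m ⊆ Ω := fun x hx => by
      by_cases hxp : p ≤ x
      · exact hsub ⟨hxp, hx⟩
      · by_contra hxΩ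
        exact hne ⟨x, hxΩ, (not_le.1 hxp).le⟩
    set σ := (v p - v m) / (m - p) with hσ
    have hσ0 : 0 < σ := div_pos (by linarith) (by linarith)
    set k := (B + 1 - v p) / σ with hk
    have hk0 : 0 < k := div_pos (by linarith [hB p]) hσ0
    have hc := hconv (p - k) m fun z hz => hIic hz.2
    have := hc.slope_mono_adjacent (x := p - k) (y := p) (z := m)
      (left_mem_Icc.2 (by linarith)) (right_mem_Icc.2 (by linarith)) (by linarith) hpm'
    rw [show p - (p - k) = k by ring, show (v m - v p) / (m - p) = -σ by rw [hσ]; ring,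
      div_le_iff₀ hk0] at this
    have h2 : σ * k = B + 1 - v p := by rw [hk]; field_simp
    linarith [hB (p - k)]

/-- The mirror image of `le_or_exists_left`. -/
lemma le_or_exists_right (hv : Continuous v) (hB : ∀ x, v x ≤ B) (hΩ : IsOpen Ω)
    (hconv : ∀ p q, Icc p q ⊆ Ω → ConvexOn ℝ (Icc p q) v) {m q : ℝ} (hmq : m ≤ q)
    (hsub : Icc m q ⊆ Ω) :
    v q ≤ v m ∨ ∃ b > q, b ∉ Ω ∧ Ico m b ⊆ Ω ∧ v q ≤ v b := by
  have := le_or_exists_left (v := fun x => v (-x)) (Ω := -Ω) (p := -q) (m := -m)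
    (by fun_prop) (fun x => hB _) hΩ.neg (fun p' q' h => ?_) (by linarith) (fun x hx => ?_)
  · simp only [neg_neg] at this
    rcases this with h | ⟨a, ha, haΩ, hI, hle⟩
    · exact Or.inl h
    · refine Or.inr ⟨-a, by linarith, by simpa using haΩ, fun x hx => ?_, hle⟩
      have := hI (show -x ∈ Ioc a (-m) from ⟨by linarith [hx.2], by linarith [hx.1]⟩)
      simpa using this
  · have h1 : Icc (-q') (-p') ⊆ Ω := fun x hx => by
      simpa using h (show -x ∈ Icc p' q' from ⟨by linarith [hx.2], by linarith [hx.1]⟩)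
    have h2 := (hconv _ _ h1).comp_linearMap (-LinearMap.id)
    have h3 : (-LinearMap.id : ℝ →ₗ[ℝ] ℝ) ⁻¹' Icc (-q') (-p') = Icc p' q' := by
      ext x; simp [and_comm]
    rw [h3] at h2
    exact h2
  · simpa using hsub (show -x ∈ Icc m q from ⟨by linarith [hx.2], by linarith [hx.1]⟩)

lemma absolutelyContinuousOnInterval_of_convexOn (hΩ : IsOpen Ω)
    (hconv : ∀ p q, Icc p q ⊆ Ω → ConvexOn ℝ (Icc p q) v) {p q : ℝ} (hpq : p ≤ q)
    (hsub : Icc p q ⊆ Ω) : AbsolutelyContinuousOnInterval v p q := by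
  -- a slightly larger interval still lies in `Ω`
  obtain ⟨a, ha, haΩ⟩ : ∃ a < p, Icc a p ⊆ Ω := by
    obtain ⟨a, ha, h⟩ := mem_nhdsLE_iff_exists_Icc_subset.1
      (mem_nhdsWithin_of_mem_nhds (hΩ.mem_nhds (hsub (left_mem_Icc.2 hpq))))
    exact ⟨a, ha, h⟩
  obtain ⟨b, hb, hbΩ⟩ : ∃ b > q, Icc q b ⊆ Ω := by
    obtain ⟨b, hb, h⟩ := mem_nhdsGE_iff_exists_Icc_subset.1
      (mem_nhdsWithin_of_mem_nhds (hΩ.mem_nhds (hsub (right_mem_Icc.2 hpq))))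
    exact ⟨b, hb, h⟩
  have hab : Icc a b ⊆ Ω := fun x hx => by
    by_cases h1 : x ≤ p
    · exact haΩ ⟨hx.1, h1⟩
    · by_cases h2 : x ≤ q
      · exact hsub ⟨(not_le.1 h1).le, h2⟩
      · exact hbΩ ⟨(not_le.1 h2).le, hx.2⟩
  have hl := (hconv a b hab).locallyLipschitzOn_interior.mono
    (show Icc p q ⊆ interior (Icc a b) by
      rw [interior_Icc]; exact fun x hx => ⟨ha.trans_le hx.1, hx.2.trans_lt hb⟩)
  obtain ⟨K, hK⟩ := hl.exists_lipschitzOnWith_of_compact isCompact_Icc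
  rw [← uIcc_of_le hpq] at hK
  exact hK.absolutelyContinuousOnInterval

end Convex

/-! ### Variation off the contact set -/

/-- The derivative of a monotone function integrates to at most its increment; equality can fail,
as no absolute continuity is assumed. -/
lemma lintegral_enorm_deriv_le_of_monotoneOn {v : ℝ → ℝ} {p q : ℝ} (hpq : p ≤ q)
    (hv : MonotoneOn v (Icc p q)) :
    ∫⁻ x in Ioc p q, ‖deriv v x‖ₑ ≤ ENNReal.ofReal (v q - v p) := by
  have hv' : MonotoneOn v (uIcc p q) := by rwa [uIcc_of_le hpq]
  have hint := (intervalIntegrable_iff_integrableOn_Ioc_of_le hpq).1 hv'.intervalIntegrable_deriv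
  rw [← ofReal_integral_norm_eq_lintegral_enorm hint]
  refine ENNReal.ofReal_le_ofReal ?_
  have hmem := hv'.intervalIntegral_deriv_mem_uIcc
  rw [uIcc_of_le (sub_nonneg.2 (hv (left_mem_Icc.2 hpq) (right_mem_Icc.2 hpq) hpq)),
    intervalIntegral.integral_of_le hpq] at hmem
  refine le_trans (le_of_eq ?_) hmem.2
  rw [integral_Ioc_eq_integral_Ioo, integral_Ioc_eq_integral_Ioo]
  refine setIntegral_congr_fun measurableSet_Ioo fun x hx => ?_
  have h := hv.derivWithin_nonneg (x := x)
  rw [derivWithin_of_mem_nhds (Icc_mem_nhds hx.1 hx.2)] at h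
  exact Real.norm_of_nonneg h

lemma lintegral_enorm_deriv_le_of_antitoneOn {v : ℝ → ℝ} {p q : ℝ} (hpq : p ≤ q)
    (hv : AntitoneOn v (Icc p q)) :
    ∫⁻ x in Ioc p q, ‖deriv v x‖ₑ ≤ ENNReal.ofReal (v p - v q) := by
  have h := lintegral_enorm_deriv_le_of_monotoneOn (v := fun x => -v x) hpq hv.neg
  simp only [deriv.fun_neg, enorm_neg] at h
  rwa [show -v q - -v p = v p - v q by ring] at h

lemma lintegral_Ioc_add_Ioc {a b c : ℝ} (hab : a ≤ b) (hbc : b ≤ c) (h : ℝ → ENNReal) :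
    (∫⁻ s in Ioc a b, h s) + ∫⁻ s in Ioc b c, h s = ∫⁻ s in Ioc a c, h s := by
  rw [← Ioc_union_Ioc_eq_Ioc hab hbc, lintegral_union measurableSet_Ioc]
  exact Set.disjoint_left.2 fun x hx hx' => not_lt.2 hx.2 hx'.1

section Obstacle

variable {v f : ℝ → ℝ} {g : ℝ → ENNReal} {B : ℝ}

/-- On an interval inside `{f < v}`, where `v` is convex, the variation of `v` is at most that of
`f` on the whole connected component: from the minimum point, `v` rises on either side at most to
its value at the boundary of the component, where it agrees with `f`. -/
lemma lintegral_enorm_deriv_Ioc_le (hv : Continuous v) (hB : ∀ x, v x ≤ B) (hfv : ∀ x, f x ≤ v x)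
    (hΩ : IsOpen {x | f x < v x})
    (hconv : ∀ p q, Icc p q ⊆ {x | f x < v x} → ConvexOn ℝ (Icc p q) v)
    (hf : ∀ x y, x ≤ y → edist (f x) (f y) ≤ ∫⁻ s in Ioc x y, g s) {p q : ℝ} (hpq : p ≤ q)
    (hsub : Icc p q ⊆ {x | f x < v x}) :
    ∫⁻ x in Ioc p q, ‖deriv v x‖ₑ ≤ ∫⁻ x in connectedComponentIn {x | f x < v x} p, g x := by
  set Ω := {x | f x < v x} with hΩdef
  have heq : ∀ a, a ∉ Ω → v a = f a := fun a ha => le_antisymm (not_lt.1 ha) (hfv a)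
  have hc := hconv p q hsub
  obtain ⟨m, hm, hmin⟩ := isCompact_Icc.exists_isMinOn ⟨p, left_mem_Icc.2 hpq⟩ hv.continuousOn
  have hmI : ∀ x ∈ Icc p q, v m ≤ v x := fun x hx => hmin hx
  have hpm : Icc p m ⊆ Ω := (Icc_subset_Icc_right hm.2).trans hsub
  have hmq : Icc m q ⊆ Ω := (Icc_subset_Icc_left hm.1).trans hsub
  have hanti : AntitoneOn v (Icc p m) := fun x hx y hy hxy => by
    have hx' : x ∈ Icc p q := ⟨hx.1, hx.2.trans hm.2⟩
    have := hc.le_max_of_mem_Icc hx' hm ⟨hxy, hy.2⟩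
    rwa [max_eq_left (hmI x hx')] at this
  have hmono : MonotoneOn v (Icc m q) := fun x hx y hy hxy => by
    have hy' : y ∈ Icc p q := ⟨hm.1.trans hy.1, hy.2⟩
    have := hc.le_max_of_mem_Icc hm hy' ⟨hx.1, hxy⟩
    rwa [max_eq_right (hmI y hy')] at this
  have hleft : ENNReal.ofReal (v p - v m) ≤ ∫⁻ x in connectedComponentIn Ω p ∩ Iic m, g x := by
    rcases le_or_exists_left hv hB hΩ hconv hm.1 hpm with h | ⟨a, hap, haΩ, hI, hle⟩
    · rw [ENNReal.ofReal_of_nonpos (by linarith)]; exact zero_le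
    · have ham : a ≤ m := hap.le.trans hm.1
      calc ENNReal.ofReal (v p - v m) ≤ edist (f a) (f m) := by
            rw [edist_dist, Real.dist_eq]
            refine ENNReal.ofReal_le_ofReal (le_trans ?_ (le_abs_self _))
            rw [← heq a haΩ]
            linarith [hfv m]
        _ ≤ ∫⁻ s in Ioc a m, g s := hf a m ham
        _ ≤ _ := lintegral_mono_set (subset_inter
            (isPreconnected_Ioc.subset_connectedComponentIn ⟨hap, hm.1⟩ hI) fun x hx => hx.2)
  have hright : ENNReal.ofReal (v q - v m) ≤ ∫⁻ x in connectedComponentIn Ω p \ Iic m, g x := by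
    rcases le_or_exists_right hv hB hΩ hconv hm.2 hmq with h | ⟨b, hqb, hbΩ, hI, hle⟩
    · rw [ENNReal.ofReal_of_nonpos (by linarith)]; exact zero_le
    · have hmb : m ≤ b := hm.2.trans hqb.le
      have hpb : Ico p b ⊆ Ω := fun x hx => by
        by_cases hxm : x ≤ m
        · exact hpm ⟨hx.1, hxm⟩
        · exact hI ⟨(not_le.1 hxm).le, hx.2⟩
      calc ENNReal.ofReal (v q - v m) ≤ edist (f m) (f b) := by
            rw [edist_comm, edist_dist, Real.dist_eq]
            refine ENNReal.ofReal_le_ofReal (le_trans ?_ (le_abs_self _))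
            rw [← heq b hbΩ]
            linarith [hfv m]
        _ ≤ ∫⁻ s in Ioc m b, g s := hf m b hmb
        _ = ∫⁻ s in Ioo m b, g s := setLIntegral_congr Ioo_ae_eq_Ioc.symm
        _ ≤ _ := lintegral_mono_set (show Ioo m b ⊆ connectedComponentIn Ω p \ Iic m from
            fun x hx =>
            ⟨isPreconnected_Ico.subset_connectedComponentIn ⟨le_rfl, hpq.trans_lt hqb⟩ hpb
              ⟨hm.1.trans hx.1.le, hx.2⟩, not_le.2 hx.1⟩)
  rw [← lintegral_Ioc_add_Ioc hm.1 hm.2, ← lintegral_inter_add_sdiff g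
    (connectedComponentIn Ω p) measurableSet_Iic]
  exact add_le_add ((lintegral_enorm_deriv_le_of_antitoneOn hm.1 hanti).trans hleft)
    ((lintegral_enorm_deriv_le_of_monotoneOn hm.2 hmono).trans hright)

lemma lintegral_enorm_deriv_component_le (hv : Continuous v) (hB : ∀ x, v x ≤ B)
    (hfv : ∀ x, f x ≤ v x) (hΩ : IsOpen {x | f x < v x})
    (hconv : ∀ p q, Icc p q ⊆ {x | f x < v x} → ConvexOn ℝ (Icc p q) v)
    (hf : ∀ x y, x ≤ y → edist (f x) (f y) ≤ ∫⁻ s in Ioc x y, g s) (x₀ : ℝ) :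
    ∫⁻ x in connectedComponentIn {x | f x < v x} x₀, ‖deriv v x‖ₑ ≤
      ∫⁻ x in connectedComponentIn {x | f x < v x} x₀, g x := by
  set Ω := {x | f x < v x} with hΩdef
  set I := connectedComponentIn Ω x₀ with hI
  have hIo : IsOpen I := hΩ.connectedComponentIn
  have hIc : OrdConnected I := isPreconnected_connectedComponentIn.ordConnected
  -- exhaust the component by intervals with rational endpoints
  let s : {r : ℚ × ℚ // (r.1 : ℝ) ∈ I ∧ (r.2 : ℝ) ∈ I ∧ r.1 ≤ r.2} → Set ℝ :=
    fun r => Ioc (r.1.1 : ℝ) r.1.2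
  have hdir : Directed (· ⊆ ·) s := by
    rintro ⟨⟨a, b⟩, ha, hb, hab⟩ ⟨⟨c, d⟩, hc, hd, hcd⟩
    refine ⟨⟨⟨min a c, max b d⟩, ?_, ?_, (min_le_left _ _).trans (hab.trans (le_max_left _ _))⟩,
      ?_, ?_⟩
    · rcases min_choice a c with h | h <;> simpa [h]
    · rcases max_choice b d with h | h <;> simpa [h]
    · exact Ioc_subset_Ioc (by exact_mod_cast min_le_left a c) (by exact_mod_cast le_max_left b d)
    · exact Ioc_subset_Ioc (by exact_mod_cast min_le_right a c)
        (by exact_mod_cast le_max_right b d)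
  have hun : I = ⋃ r, s r := by
    ext x
    simp only [mem_iUnion]
    constructor
    · intro hx
      obtain ⟨l, u, ⟨hl, hu⟩, hlu⟩ := mem_nhds_iff_exists_Ioo_subset.1 (hIo.mem_nhds hx)
      obtain ⟨a, hla, hax⟩ := exists_rat_btwn hl
      obtain ⟨b, hxb, hbu⟩ := exists_rat_btwn hu
      exact ⟨⟨⟨a, b⟩, hlu ⟨hla, hax.trans hu⟩, hlu ⟨hl.trans hxb, hbu⟩,
        by exact_mod_cast (hax.trans hxb).le⟩, hax, hxb.le⟩
    · rintro ⟨⟨⟨a, b⟩, ha, hb, hab⟩, hx⟩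
      exact hIc.out ha hb ⟨hx.1.le, hx.2⟩
  have hle : ∀ r, ∫⁻ x in s r, ‖deriv v x‖ₑ ≤ ∫⁻ x in I, g x := by
    rintro ⟨⟨a, b⟩, ha, hb, hab⟩
    have hab' : (a : ℝ) ≤ b := by exact_mod_cast hab
    have := lintegral_enorm_deriv_Ioc_le hv hB hfv hΩ hconv hf hab'
      ((hIc.out ha hb).trans (connectedComponentIn_subset _ _))
    rwa [← hΩdef, ← connectedComponentIn_eq ha] at this
  calc ∫⁻ x in I, ‖deriv v x‖ₑ = ⨆ r, ∫⁻ x in s r, ‖deriv v x‖ₑ :=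
        (congrArg (fun A => ∫⁻ x in A, ‖deriv v x‖ₑ) hun).trans
          (setLIntegral_iUnion_of_directed _ hdir)
    _ ≤ _ := iSup_le hle

/-- The bound on each connected component of `{f < v}`, summed over the countably many of them. -/
lemma lintegral_enorm_deriv_le (hv : Continuous v) (hB : ∀ x, v x ≤ B)
    (hfv : ∀ x, f x ≤ v x) (hΩ : IsOpen {x | f x < v x})
    (hconv : ∀ p q, Icc p q ⊆ {x | f x < v x} → ConvexOn ℝ (Icc p q) v)
    (hf : ∀ x y, x ≤ y → edist (f x) (f y) ≤ ∫⁻ s in Ioc x y, g s) :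
    ∫⁻ x in {x | f x < v x}, ‖deriv v x‖ₑ ≤ ∫⁻ x, g x := by
  set Ω := {x | f x < v x} with hΩdef
  set S : Set (Set ℝ) := connectedComponentIn Ω '' Ω with hS
  have hSo : ∀ I ∈ S, IsOpen I := by
    rintro _ ⟨x, -, rfl⟩; exact hΩ.connectedComponentIn
  have hdisj : S.PairwiseDisjoint id := by
    rintro _ ⟨x, hx, rfl⟩ _ ⟨y, hy, rfl⟩ hne
    refine Set.disjoint_left.2 fun z hzx hzy => hne ?_
    rw [connectedComponentIn_eq hzx, connectedComponentIn_eq hzy]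
  have hSc : S.Countable := hdisj.countable_of_isOpen hSo (by
    rintro _ ⟨x, hx, rfl⟩; exact ⟨x, mem_connectedComponentIn hx⟩)
  have hun : Ω = ⋃ I ∈ S, I := by
    ext x
    simp only [mem_iUnion, hS, mem_image, exists_prop, exists_exists_and_eq_and]
    exact ⟨fun hx => ⟨x, hx, mem_connectedComponentIn hx⟩,
      fun ⟨y, _, hx⟩ => connectedComponentIn_subset _ _ hx⟩
  have hsplit : ∀ F : ℝ → ENNReal, ∫⁻ x in Ω, F x = ∑' I : S, ∫⁻ x in (I : Set ℝ), F x :=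
    fun F => (congrArg (fun A => ∫⁻ x in A, F x) hun).trans
      (lintegral_biUnion (s := id) hSc (fun I hI => (hSo I hI).measurableSet) hdisj F)
  refine le_trans ?_ (setLIntegral_le_lintegral Ω g)
  rw [hsplit, hsplit]
  refine ENNReal.tsum_le_tsum ?_
  rintro ⟨_, x, hx, rfl⟩
  exact lintegral_enorm_deriv_component_le hv hB hfv hΩ hconv hf x

/-- The increments of `v` are controlled by `g` across the contact set `{v = f}` and by `|v'|` on
its complement. -/
lemma edist_le_lintegral_add_indicator (hv : Continuous v)
    (hfv : ∀ x, f x ≤ v x) (hΩ : IsOpen {x | f x < v x})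
    (hconv : ∀ p q, Icc p q ⊆ {x | f x < v x} → ConvexOn ℝ (Icc p q) v)
    (hf : ∀ x y, x ≤ y → edist (f x) (f y) ≤ ∫⁻ s in Ioc x y, g s) {x y : ℝ} (hxy : x ≤ y) :
    edist (v x) (v y) ≤ ∫⁻ s in Ioc x y,
      (g s + {x | f x < v x}.indicator (fun s => ‖deriv v s‖ₑ) s) := by
  set Ω := {x | f x < v x} with hΩdef
  set h : ℝ → ENNReal := fun s => g s + Ω.indicator (fun s => ‖deriv v s‖ₑ) s with hh
  have heq : ∀ a, a ∉ Ω → v a = f a := fun a ha => le_antisymm (not_lt.1 ha) (hfv a)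
  have hclosed : ∀ a b, a ≤ b → Icc a b ⊆ Ω → edist (v a) (v b) ≤ ∫⁻ s in Ioc a b, h s :=
    fun a b hab hsub => by
      have hac := (absolutelyContinuousOnInterval_of_convexOn hΩ hconv hab hsub)
      rw [edist_comm, edist_eq_enorm_sub, ← hac.integral_deriv_eq_sub,
        intervalIntegral.integral_of_le hab]
      refine (enorm_integral_le_lintegral_enorm _).trans
        (setLIntegral_mono' measurableSet_Ioc fun s hs => ?_)
      simp only [hh, indicator_of_mem (hsub (Ioc_subset_Icc_self hs))]
      exact le_add_self
  have hopen : ∀ a b, a ≤ b → Ioo a b ⊆ Ω → edist (v a) (v b) ≤ ∫⁻ s in Ioc a b, h s :=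
    fun a b hab hsub => by
      rcases hab.eq_or_lt with rfl | hab
      · simp
      have hin : ∀ a' ∈ Ioo a b, ∀ b' ∈ Ioo a' b, edist (v a') (v b') ≤ ∫⁻ s in Ioc a b, h s :=
        fun a' ha' b' hb' => (hclosed a' b' hb'.1.le fun z hz =>
          hsub ⟨ha'.1.trans_le hz.1, hz.2.trans_lt hb'.2⟩).trans
          (lintegral_mono_set (Ioc_subset_Ioc ha'.1.le hb'.2.le))
      have hin2 : ∀ a' ∈ Ioo a b, edist (v a') (v b) ≤ ∫⁻ s in Ioc a b, h s := fun a' ha' => by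
        have ht : Tendsto (fun b' => edist (v a') (v b')) (𝓝[<] b) (𝓝 (edist (v a') (v b))) :=
          (tendsto_const_nhds.edist hv.continuousAt).mono_left nhdsWithin_le_nhds
        refine le_of_tendsto ht ?_
        filter_upwards [Ioo_mem_nhdsLT ha'.2] with b' hb' using hin a' ha' b' hb'
      have ht : Tendsto (fun a' => edist (v a') (v b)) (𝓝[>] a) (𝓝 (edist (v a) (v b))) :=
        (Tendsto.edist hv.continuousAt tendsto_const_nhds).mono_left nhdsWithin_le_nhds
      refine le_of_tendsto ht ?_
      filter_upwards [Ioo_mem_nhdsGT hab] with a' ha' using hin2 a' ha'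
  -- split `[x, y]` at its first and its last contact point
  by_cases hne : (Ωᶜ ∩ Icc x y).Nonempty
  · have hK : IsCompact (Ωᶜ ∩ Icc x y) := isCompact_Icc.inter_left hΩ.isClosed_compl
    set a := sInf (Ωᶜ ∩ Icc x y) with ha
    set b := sSup (Ωᶜ ∩ Icc x y) with hb
    have ham : a ∈ Ωᶜ ∩ Icc x y := hK.sInf_mem hne
    have hbm : b ∈ Ωᶜ ∩ Icc x y := hK.sSup_mem hne
    have hab : a ≤ b := csInf_le hK.bddBelow hbm
    have hxa : Ioo x a ⊆ Ω := fun z hz => by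
      by_contra hzn
      exact not_le.2 hz.2 (csInf_le hK.bddBelow ⟨hzn, hz.1.le, hz.2.le.trans ham.2.2⟩)
    have hby : Ioo b y ⊆ Ω := fun z hz => by
      by_contra hzn
      exact not_le.2 hz.1 (le_csSup hK.bddAbove ⟨hzn, hbm.2.1.trans hz.1.le, hz.2.le⟩)
    have hmid : edist (v a) (v b) ≤ ∫⁻ s in Ioc a b, h s := by
      rw [heq a ham.1, heq b hbm.1]
      exact (hf a b hab).trans (lintegral_mono fun s => le_self_add)
    calc edist (v x) (v y) ≤ edist (v x) (v a) + edist (v a) (v b) + edist (v b) (v y) :=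
          edist_triangle4 _ _ _ _
      _ ≤ (∫⁻ s in Ioc x a, h s) + (∫⁻ s in Ioc a b, h s) + ∫⁻ s in Ioc b y, h s :=
          add_le_add (add_le_add (hopen x a ham.2.1 hxa) hmid) (hopen b y hbm.2.2 hby)
      _ = _ := by
          rw [lintegral_Ioc_add_Ioc ham.2.1 hab,
            lintegral_Ioc_add_Ioc (ham.2.1.trans hab) hbm.2.2]
  · exact hclosed x y hxy fun z hz => by
      by_contra hzn
      exact hne ⟨z, hzn, hz⟩

/-- A continuous `v ≥ f`, bounded above, that is convex off the contact set `{v = f}` inherits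
absolute continuity from `f`, and its total variation is controlled by that of `f`. The constant
`2` comes from adding the contributions of the contact set and of its complement. -/
theorem absolutelyContinuous_of_convexOn_off_contact {G : ℝ → ℝ} (hG : Integrable G)
    (hv : Continuous v) (hB : ∀ x, v x ≤ B) (hfv : ∀ x, f x ≤ v x) (hΩ : IsOpen {x | f x < v x})
    (hconv : ∀ p q, Icc p q ⊆ {x | f x < v x} → ConvexOn ℝ (Icc p q) v)
    (hf : ∀ x y, x ≤ y → |f y - f x| ≤ ∫ s in x..y, |G s|) :
    (∀ a b, AbsolutelyContinuousOnInterval v a b) ∧ Integrable (deriv v) ∧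
      ∫ x, |deriv v x| ≤ 2 * ∫ x, |G x| := by
  set Ω := {x | f x < v x} with hΩdef
  have hfe : ∀ x y, x ≤ y → edist (f x) (f y) ≤ ∫⁻ s in Ioc x y, ‖G s‖ₑ := fun x y hxy => by
    rw [edist_comm, edist_dist, Real.dist_eq, ← ofReal_integral_norm_eq_lintegral_enorm
      hG.integrableOn, ← intervalIntegral.integral_of_le hxy]
    exact ENNReal.ofReal_le_ofReal (hf x y hxy)
  have hΩle := lintegral_enorm_deriv_le hv hB hfv hΩ hconv hfe
  have hfin : ∫⁻ x, ‖G x‖ₑ < ⊤ := hG.2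
  have hdΩ : IntegrableOn (deriv v) Ω :=
    ⟨(measurable_deriv v).aestronglyMeasurable, hΩle.trans_lt hfin⟩
  set H : ℝ → ℝ := fun s => |G s| + Ω.indicator (fun s => |deriv v s|) s with hH
  have hind : Integrable (Ω.indicator fun s => |deriv v s|) :=
    (integrable_indicator_iff hΩ.measurableSet).2 hdΩ.abs
  have hHi : Integrable H := hG.abs.add hind
  have hH0 : ∀ x, 0 ≤ H x := fun x =>
    add_nonneg (abs_nonneg _) (indicator_nonneg (fun _ _ => abs_nonneg _) _)
  have hHe : ∀ s, ‖H s‖ₑ = ‖G s‖ₑ + Ω.indicator (fun s => ‖deriv v s‖ₑ) s := fun s => by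
    rw [Real.enorm_of_nonneg (hH0 s), hH, ENNReal.ofReal_add (abs_nonneg _)
      (indicator_nonneg (fun _ _ => abs_nonneg _) _), ← Real.enorm_eq_ofReal_abs]
    congr 1
    by_cases hs : s ∈ Ω
    · simp only [indicator_of_mem hs, Real.enorm_eq_ofReal_abs]
    · simp [indicator_of_notMem hs]
  have hinc : ∀ x y, x ≤ y → |v y - v x| ≤ ∫ s in x..y, H s := fun x y hxy => by
    have h1 := edist_le_lintegral_add_indicator hv hfv hΩ hconv hfe hxy
    simp only [← hΩdef, ← hHe] at h1
    rw [← ofReal_integral_norm_eq_lintegral_enorm hHi.integrableOn, edist_comm, edist_dist,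
      Real.dist_eq, ENNReal.ofReal_le_ofReal_iff (integral_nonneg fun _ => norm_nonneg _)] at h1
    rw [intervalIntegral.integral_of_le hxy]
    simpa only [Real.norm_of_nonneg (hH0 _)] using h1
  obtain ⟨h1, h2, h3⟩ := absolutelyContinuous_of_abs_sub_le_integral hHi hH0 hinc
  refine ⟨h1, h2, h3.trans ?_⟩
  have h4 : ∫ x in Ω, |deriv v x| ≤ ∫ x, |G x| := by
    have := hΩle
    rw [← ofReal_integral_norm_eq_lintegral_enorm hdΩ,
      ← ofReal_integral_norm_eq_lintegral_enorm hG,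
      ENNReal.ofReal_le_ofReal_iff (integral_nonneg fun _ => norm_nonneg _)] at this
    exact this
  rw [hH, integral_add hG.abs hind, integral_indicator hΩ.measurableSet]
  linarith

end Obstacle

/-! ### Weak derivatives and Sobolev functions on the line -/

/-- On the line the weak gradient is the usual weak derivative. -/
lemma hasWeakGradient_real_iff {u G : ℝ → ℝ} :
    HasWeakGradient u G ↔ LocallyIntegrable u ∧ LocallyIntegrable G ∧
      ∀ η : ℝ → ℝ, ContDiff ℝ (⊤ : ℕ∞) η → HasCompactSupport η →
        ∫ x, u x * deriv η x = - ∫ x, G x * η x := by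
  refine and_congr_right fun _ => and_congr_right fun _ => forall₃_congr fun η _ _ => ?_
  constructor
  · intro h
    simpa using h 1
  · intro h v
    have h1 : ∀ x, u x * fderiv ℝ η x v = v * (u x * deriv η x) := fun x => by
      rw [fderiv_eq_smul_deriv, smul_eq_mul]; ring
    have h2 : ∀ x, inner ℝ (G x) v * η x = v * (G x * η x) := fun x => by
      simp only [RCLike.inner_apply, conj_trivial]; ring
    simp only [h1, h2, integral_const_mul, h]
    ring

lemma exists_tsupport_subset_Ioo {η : ℝ → ℝ} (hη : HasCompactSupport η) :
    ∃ R : ℝ, 0 < R ∧ tsupport η ⊆ Ioo (-R) R := by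
  obtain ⟨R, hR⟩ := hη.isCompact.isBounded.subset_ball (0 : ℝ)
  refine ⟨max R 1, by positivity, hR.trans ?_⟩
  rw [Real.ball_eq_Ioo, zero_sub, zero_add]
  exact Ioo_subset_Ioo (neg_le_neg (le_max_left _ _)) (le_max_left _ _)

/-- A locally absolutely continuous function has its pointwise derivative as weak derivative. -/
lemma hasWeakGradient_deriv {v : ℝ → ℝ} (hv : ∀ a b, AbsolutelyContinuousOnInterval v a b)
    (hvl : LocallyIntegrable v) (hi : LocallyIntegrable (deriv v)) :
    HasWeakGradient v (deriv v) := by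
  refine hasWeakGradient_real_iff.2 ⟨hvl, hi, fun η hη hηc => ?_⟩
  obtain ⟨R, hR, hsub⟩ := exists_tsupport_subset_Ioo hηc
  have hs : tsupport η ⊆ Ioc (-R) R := hsub.trans Ioo_subset_Ioc_self
  have h0 : ∀ x, x ∉ Ioo (-R) R → η x = 0 := fun x hx => by
    by_contra h
    exact hx (hsub (subset_tsupport η h))
  have hηac : AbsolutelyContinuousOnInterval η (-R) R :=
    (hη.of_le (by exact_mod_cast le_top)).contDiffOn.absolutelyContinuousOnInterval
  have hparts := (hv (-R) R).integral_mul_deriv_eq_deriv_mul hηac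
  rw [h0 R (by simp), h0 (-R) (by simp),
    intervalIntegral.integral_eq_integral_of_support_subset,
    intervalIntegral.integral_eq_integral_of_support_subset] at hparts
  · rw [hparts]; ring
  · exact (Function.support_mul_subset_right _ _).trans ((subset_tsupport η).trans hs)
  · exact (Function.support_mul_subset_right _ _).trans ((support_deriv_subset).trans hs)

lemma HasWeakGradient.unique {u g g' : ℝ → ℝ} (h : HasWeakGradient u g)
    (h' : HasWeakGradient u g') : g' =ᵐ[volume] g := by
  obtain ⟨-, hg, h⟩ := hasWeakGradient_real_iff.1 h
  obtain ⟨-, hg', h'⟩ := hasWeakGradient_real_iff.1 h'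
  refine ae_eq_of_integral_contDiff_smul_eq hg' hg fun η hη hηc => ?_
  have := (h η hη hηc).symm.trans (h' η hη hηc)
  simp only [smul_eq_mul, mul_comm (η _)]
  linarith

/-- A test function with integral zero is the derivative of a test function. -/
lemma exists_deriv_eq_of_integral_eq_zero {θ : ℝ → ℝ} (hθ : ContDiff ℝ (⊤ : ℕ∞) θ)
    (hθc : HasCompactSupport θ) (h0 : ∫ x, θ x = 0) :
    ∃ η : ℝ → ℝ, ContDiff ℝ (⊤ : ℕ∞) η ∧ HasCompactSupport η ∧ deriv η = θ := by
  obtain ⟨R, hR, hsub⟩ := exists_tsupport_subset_Ioo hθc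
  have hz : ∀ x, x ∉ Ioo (-R) R → θ x = 0 := fun x hx => by
    by_contra h
    exact hx (hsub (subset_tsupport θ h))
  have hder : ∀ x, HasDerivAt (fun x => ∫ s in (-R)..x, θ s) (θ x) x := fun x =>
    intervalIntegral.integral_hasDerivAt_right (hθ.continuous.intervalIntegrable _ _)
      (hθ.continuous.stronglyMeasurableAtFilter _ _) hθ.continuous.continuousAt
  have hd : deriv (fun x => ∫ s in (-R)..x, θ s) = θ := funext fun x => (hder x).deriv
  refine ⟨fun x => ∫ s in (-R)..x, θ s, ?_, ?_, hd⟩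
  · rw [contDiff_infty_iff_deriv, hd]
    exact ⟨fun x => (hder x).differentiableAt, hθ⟩
  · refine HasCompactSupport.intro (isCompact_Icc (a := -R) (b := R)) fun x hx => ?_
    rcases lt_or_ge x (-R) with hxR | hxR
    · refine intervalIntegral.integral_zero_ae (Eventually.of_forall fun s hs => hz s fun h => ?_)
      rw [uIoc_of_ge hxR.le] at hs
      exact not_lt.2 hs.2 h.1
    · have hxR' : R < x := by
        by_contra h
        exact hx ⟨hxR, not_lt.1 h⟩
      rw [intervalIntegral.integral_eq_integral_of_support_subset, h0]
      exact (subset_tsupport θ).trans (hsub.trans fun s hs => ⟨hs.1, hs.2.le.trans hxR'.le⟩)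

/-- The du Bois-Reymond lemma: a function with vanishing weak derivative is constant. -/
lemma ae_eq_const_of_hasWeakGradient_zero {w : ℝ → ℝ} (hw : HasWeakGradient w 0) :
    ∃ c : ℝ, w =ᵐ[volume] fun _ => c := by
  obtain ⟨hwl, -, hw⟩ := hasWeakGradient_real_iff.1 hw
  let b : ContDiffBump (0 : ℝ) := ⟨1, 2, one_pos, one_lt_two⟩
  set ρ : ℝ → ℝ := b.normed volume with hρ
  have hρ1 : ∫ x, ρ x = 1 := b.integral_normed
  have hρs : ContDiff ℝ (⊤ : ℕ∞) ρ := b.contDiff_normed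
  have hρc : HasCompactSupport ρ := b.hasCompactSupport_normed
  have hint : ∀ ψ : ℝ → ℝ, ContDiff ℝ (⊤ : ℕ∞) ψ → HasCompactSupport ψ →
      Integrable fun x => ψ x • w x := fun ψ hψ hψc =>
    hwl.integrable_smul_left_of_hasCompactSupport hψ.continuous hψc
  refine ⟨∫ x, ρ x • w x, ?_⟩
  refine ae_eq_of_integral_contDiff_smul_eq hwl continuous_const.locallyIntegrable
    fun ψ hψ hψc => ?_
  have hψi : Integrable ψ := hψ.continuous.integrable_of_hasCompactSupport hψc
  have hρi : Integrable ρ := hρs.continuous.integrable_of_hasCompactSupport hρc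
  -- `ψ - (∫ ψ) ρ` has integral zero, so it is the derivative of a test function
  set a := ∫ x, ψ x with ha
  obtain ⟨η, hη, hηc, hηd⟩ := exists_deriv_eq_of_integral_eq_zero
    (θ := fun x => ψ x - a * ρ x) (hψ.sub (contDiff_const.mul hρs))
    (hψc.sub (hρc.mul_left)) (by
      rw [integral_sub hψi (hρi.const_mul a), integral_const_mul, hρ1, ← ha]; ring)
  have h1 := hw η hη hηc
  rw [hηd] at h1
  simp only [Pi.zero_apply, zero_mul, integral_zero, neg_zero] at h1
  have h2 : ∀ x, w x * (ψ x - a * ρ x) = ψ x • w x - a * (ρ x • w x) := fun x => by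
    simp only [smul_eq_mul]; ring
  simp only [h2] at h1
  rw [integral_sub (hint ψ hψ hψc) ((hint ρ hρs hρc).const_mul a), integral_const_mul] at h1
  simp only [smul_eq_mul] at h1 ⊢
  rw [integral_mul_const]
  linarith

/-- A function in `W^{1,1}(ℝ)` agrees almost everywhere with a primitive of its weak derivative. -/
lemma IsW11.exists_continuous_representative {u u' : ℝ → ℝ} (h : IsW11 u u') :
    ∃ w : ℝ → ℝ, Continuous w ∧ w =ᵐ[volume] u ∧
      ∀ x y, x ≤ y → w y - w x = ∫ s in x..y, u' s := by
  obtain ⟨hu, hu', hw⟩ := h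
  set U : ℝ → ℝ := fun x => ∫ s in (0)..x, u' s with hU
  have hUsub : ∀ x y, U y - U x = ∫ s in x..y, u' s := fun x y =>
    intervalIntegral.integral_interval_sub_left hu'.intervalIntegrable hu'.intervalIntegrable
  have hUc : Continuous U := intervalIntegral.continuous_primitive
    (fun a b => hu'.intervalIntegrable) 0
  obtain ⟨hUac, hUi, -⟩ := absolutelyContinuous_of_abs_sub_le_integral (v := U) hu'.abs
    (fun x => abs_nonneg _) (fun x y hxy => by
      rw [hUsub]; exact intervalIntegral.abs_integral_le_integral_abs hxy)
  have hUw := hasWeakGradient_deriv hUac hUc.locallyIntegrable hUi.locallyIntegrable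
  have hae : deriv U =ᵐ[volume] u' := by
    filter_upwards [LocallyIntegrable.ae_hasDerivAt_integral hu'.locallyIntegrable] with x hx
    exact (hx 0).deriv
  have hdiff : HasWeakGradient (fun x => u x - U x) 0 := by
    obtain ⟨hul, -, hw⟩ := hasWeakGradient_real_iff.1 hw
    obtain ⟨hUl, -, hUw⟩ := hasWeakGradient_real_iff.1 hUw
    refine hasWeakGradient_real_iff.2 ⟨hul.sub hUl, locallyIntegrable_zero, fun η hη hηc => ?_⟩
    have hdc : Continuous (deriv η) := hη.continuous_deriv (by exact_mod_cast le_top)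
    have hI : ∀ f : ℝ → ℝ, LocallyIntegrable f → Integrable fun x => f x * deriv η x :=
      fun f hf => by
        simpa only [smul_eq_mul, mul_comm] using
          hf.integrable_smul_left_of_hasCompactSupport hdc hηc.deriv
    have h3 : ∫ x, deriv U x * η x = ∫ x, u' x * η x :=
      integral_congr_ae (hae.mul (ae_eq_refl η))
    simp only [sub_mul, Pi.zero_apply, zero_mul, integral_zero, neg_zero]
    rw [integral_sub (hI u hul) (hI U hUl), hw η hη hηc, hUw η hη hηc, h3, sub_self]
  obtain ⟨c, hc⟩ := ae_eq_const_of_hasWeakGradient_zero hdiff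
  refine ⟨fun x => U x + c, hUc.add continuous_const, ?_, fun x y _ => ?_⟩
  · filter_upwards [hc] with x hx
    linarith
  · rw [← hUsub]; ring

/-- On the line, subharmonic functions are convex on the intervals inside their domain. -/
lemma SubharmonicOn.convexOn_Icc {v : ℝ → ℝ} {Ω : Set ℝ} (hv : SubharmonicOn v Ω) {p q : ℝ}
    (hsub : Icc p q ⊆ Ω) : ConvexOn ℝ (Icc p q) v := by
  refine LinearOrder.convexOn_of_lt (convex_Icc p q) fun x hx y hy hxy a b ha hb hab => ?_
  set σ := (v y - v x) / (y - x) with hσ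
  have hyx : 0 < y - x := by linarith
  have hball : closedBall ((x + y) / 2) ((y - x) / 2) = Icc x y := by
    rw [Real.closedBall_eq_Icc]; congr 1 <;> ring
  have hball' : ball ((x + y) / 2) ((y - x) / 2) = Ioo x y := by
    rw [Real.ball_eq_Ioo]; congr 1 <;> ring
  have haff : ContDiff ℝ 2 fun s : ℝ => v x + σ * (s - x) := by fun_prop
  have hd1 : deriv (fun s : ℝ => v x + σ * (s - x)) = fun _ => σ := funext fun s => by
    simp
  have hharm : InnerProductSpace.HarmonicOnNhd (fun s : ℝ => v x + σ * (s - x))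
      (ball ((x + y) / 2) ((y - x) / 2)) := fun s _ => by
    refine ⟨haff.contDiffAt, Eventually.of_forall fun r => ?_⟩
    rw [InnerProductSpace.laplacian_eq_iteratedDeriv_real, iteratedDeriv_succ, iteratedDeriv_one,
      hd1]
    simp
  have := hv.2.2 ((x + y) / 2) ((y - x) / 2) (by linarith)
    (by rw [hball]; exact (Icc_subset_Icc hx.1 hy.2).trans hsub)
    (fun s => v x + σ * (s - x)) haff.continuous.continuousOn hharm (fun s hs => ?_)
    (a * x + b * y) (by
      rw [hball']
      have : a = 1 - b := by linarith
      subst this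
      constructor <;> nlinarith)
  · refine this.trans (le_of_eq ?_)
    have h1 : a = 1 - b := by linarith
    simp only [smul_eq_mul]
    rw [h1, hσ]
    field_simp
    ring
  · rw [mem_sphere, Real.dist_eq] at hs
    rcases (abs_eq (by linarith)).1 hs with h | h
    · have : s = y := by linarith
      rw [this, hσ]
      field_simp
      simp
    · have : s = x := by linarith
      rw [this]; simp

/-- The kernels have mass one, so `u*` inherits every bound of `|u|`. -/
lemma maximal_le_of_abs_le {α : ℝ} (hα1 : α < 1) {u : ℝ → ℝ} (hu : Integrable u) {B : ℝ}
    (hB : ∀ x, |u x| ≤ B) (x : ℝ) : maximal (kernel ℝ α) u x ≤ B := by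
  refine maximal_le fun t ht => ?_
  rw [extension_eq_translate, ← mul_one B, ← integral_dilate_kernel (E := ℝ) hα1 ht,
    ← integral_const_mul]
  exact integral_mono (integrable_comp_sub_left_mul_dilate hα1 hu x ht)
    ((integrable_dilate_kernel hα1 ht).const_mul B)
    fun z => mul_le_mul_of_nonneg_right (hB _) (dilate_kernel_nonneg α ht z)

/-- The maximal function of a `W^{1,1}(ℝ)` function is absolutely continuous, with
`‖(u*)'‖₁ ≤ 2 ‖u'‖₁`. -/
theorem absolutelyContinuous_maximal {α : ℝ} (hα1 : α < 1) {w w' : ℝ → ℝ} (hw : Integrable w)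
    (hwc : Continuous w) (hw' : Integrable w')
    (hww' : ∀ x y, x ≤ y → w y - w x = ∫ s in x..y, w' s) :
    (∀ a b, AbsolutelyContinuousOnInterval (maximal (kernel ℝ α) w) a b) ∧
      Integrable (deriv (maximal (kernel ℝ α) w)) ∧
      ∫ x, |deriv (maximal (kernel ℝ α) w) x| ≤ 2 * ∫ x, |w' x| := by
  have hinc : ∀ x y, x ≤ y → |w y - w x| ≤ ∫ s in x..y, |w' s| := fun x y hxy => by
    rw [hww' x y hxy]; exact intervalIntegral.abs_integral_le_integral_abs hxy
  have hle : ∀ x y, x ≤ y → |w y - w x| ≤ ∫ s, |w' s| := fun x y hxy =>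
    (hinc x y hxy).trans (by
      rw [intervalIntegral.integral_of_le hxy]
      exact setIntegral_le_integral hw'.abs (Eventually.of_forall fun _ => abs_nonneg _))
  have hB : ∀ x, |w x| ≤ |w 0| + ∫ s, |w' s| := fun x => by
    have h1 : |w x - w 0| ≤ ∫ s, |w' s| := by
      rcases le_total 0 x with h | h
      · exact hle 0 x h
      · rw [abs_sub_comm]; exact hle x 0 h
    linarith [abs_sub_abs_le_abs_sub (w x) (w 0)]
  have hsub := subharmonicOn_maximal (E := ℝ) hα1 hw hwc
  exact absolutelyContinuous_of_convexOn_off_contact hw' (continuous_maximal hα1 hw hwc)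
    (maximal_le_of_abs_le hα1 hw hB) (fun x => abs_le_maximal hα1 hw hwc.continuousAt) hsub.1
    (fun p q h => hsub.convexOn_Icc h)
    (fun x y hxy => (abs_abs_sub_abs_le_abs_sub _ _).trans (hinc x y hxy))

end FracPoisson

end

theorem mainTheorem2 (α : ℝ) (hα0 : 0 < α) (hα1 : α < 1) :
    (∀ d : ℕ, 1 ≤ d →
      ∀ (u : EuclideanSpace ℝ (Fin d) → ℝ)
        (G : EuclideanSpace ℝ (Fin d) → EuclideanSpace ℝ (Fin d)),
        FracPoisson.IsW11 u G → Continuous u →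
          (∀ x, BddAbove (FracPoisson.extensionValues
            (FracPoisson.kernel (EuclideanSpace ℝ (Fin d)) α) u x)) ∧
          Continuous (FracPoisson.maximal
            (FracPoisson.kernel (EuclideanSpace ℝ (Fin d)) α) u) ∧
          FracPoisson.SubharmonicOn
            (FracPoisson.maximal (FracPoisson.kernel (EuclideanSpace ℝ (Fin d)) α) u)
            {x | |u x| <
              FracPoisson.maximal (FracPoisson.kernel (EuclideanSpace ℝ (Fin d)) α) u x}) ∧
    (∃ C : ℝ, ∀ u u' : ℝ → ℝ, FracPoisson.IsW11 u u' →
      (∀ x, BddAbove (FracPoisson.extensionValues (FracPoisson.kernel ℝ α) u x)) ∧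
      (∀ v : ℝ → ℝ, v =ᵐ[volume] u →
        FracPoisson.maximal (FracPoisson.kernel ℝ α) v =
          FracPoisson.maximal (FracPoisson.kernel ℝ α) u) ∧
      ∃ g : ℝ → ℝ, Integrable g ∧
        FracPoisson.HasWeakGradient (FracPoisson.maximal (FracPoisson.kernel ℝ α) u) g ∧
        (∀ g' : ℝ → ℝ,
          FracPoisson.HasWeakGradient (FracPoisson.maximal (FracPoisson.kernel ℝ α) u) g' →
            g' =ᵐ[volume] g) ∧
        ∫ x, |g x| ≤ C * FracPoisson.normW11 u u') := by
  refine ⟨fun d hd u G hu huc => ?_, 2, fun u u' hu => ?_⟩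
  · -- `d ≠ 0` makes the space nontrivial, so that `ũ(x, t) → 0` as `t → ∞`
    have : NeZero d := ⟨by omega⟩
    exact ⟨fun x => FracPoisson.bddAbove_extensionValues hα1 hu.1 huc.continuousAt,
      FracPoisson.continuous_maximal hα1 hu.1 huc, FracPoisson.subharmonicOn_maximal hα1 hu.1 huc⟩
  · -- `u*` does not change when `u` is replaced by its continuous representative
    obtain ⟨w, hwc, hwu, hww'⟩ := hu.exists_continuous_representative
    have hw : Integrable w := hu.1.congr hwu.symm
    have hmax : FracPoisson.maximal (FracPoisson.kernel ℝ α) w =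
        FracPoisson.maximal (FracPoisson.kernel ℝ α) u := FracPoisson.maximal_congr_ae hwu
    obtain ⟨hac, hi, hle⟩ := FracPoisson.absolutelyContinuous_maximal hα1 hw hwc hu.2.1 hww'
    have hmc : Continuous (FracPoisson.maximal (FracPoisson.kernel ℝ α) w) :=
      FracPoisson.continuous_maximal hα1 hw hwc
    have hweak := FracPoisson.hasWeakGradient_deriv hac hmc.locallyIntegrable hi.locallyIntegrable
    rw [hmax] at hac hi hle hweak
    refine ⟨fun x => ?_, fun v hv => FracPoisson.maximal_congr_ae hv, _, hi, hweak,
      fun g' hg' => hweak.unique hg', hle.trans ?_⟩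
    · rw [FracPoisson.extensionValues, ← FracPoisson.extension_congr_ae hwu]
      exact FracPoisson.bddAbove_extensionValues hα1 hw hwc.continuousAt
    · have h0 : 0 ≤ ∫ x, |u x| := integral_nonneg fun x => abs_nonneg _
      simp only [FracPoisson.normW11, Real.norm_eq_abs]
      linarith
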